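/- Let $\mathbb K$ be a field of characteristic $0$ and $A$ a $\mathbb K$-vector space. A Hom-alternative algebra $(A,\mu,\alpha)$ consists of a bilinear map $\mu:A\times A\to A$ and a linear map $\alpha:A\to A$ such that $\alpha(\mu(x,y))=\mu(\alpha(x),\alpha(y))$, $\mu(\mu(x,x),\alpha(y))=\mu(\alpha(x),\mu(x,y))$ and $\mu(\mu(x,y),\alpha(y))=\mu(\alpha(x),\mu(y,y))$ for all $x,y\in A$. A two-sided Hom-ideal is a subspace $H$ with $\alpha(H)\subseteq H$, $\mu(A,H)\subseteq H$ and $\mu(H,A)\subseteq H$. The Hom-alternative algebra is simple if $\alpha\neq 0$, $\mu(A,A)\neq\{0\}$ and its only two-sided Hom-ideals are $\{0\}$ and $A$. An alternative algebra $(A,\mu')$ is a bilinear product with $\mu'(\mu'(x,x),y)=\mu'(x,\mu'(x,y))$ and $\mu'(\mu'(x,y),y)=\mu'(x,\mu'(y,y))$ for all $x,y\in A$; it is simple if $\mu'(A,A)\neq\{0\}$ and its only two-sided ideals are $\{0\}$ and $A$. A simple ideal of $(A,\mu')$ is a two-sided ideal that is simple as an algebra under the restriction of $\mu'$, and $(A,\mu')$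 is semi-simple if it is the direct sum of finitely many simple ideals. (1) Let $A$ be finite-dimensional and let $(A,\mu,\alpha)$ be a simple Hom-alternative algebra. Then $\alpha$ is bijective, $(A,\mu')$ with $\mu'=\alpha^{-1}\circ\mu$ is an alternative algebra (the induced alternative algebra), $\alpha$ is an automorphism of $(A,\mu')$, and $(A,\mu')$ is semi-simple. Any two simple ideals of $(A,\mu')$ are isomorphic as algebras. The set of simple ideals of $(A,\mu')$ is finite and non-empty; let $m$ be its number of elements. Then $\alpha$ permutes this set simply transitively, in the sense that $I\mapsto\alpha(I)$ is a bijection of the set onto itself and for any simple ideals $I,J$ there is exactly one $k\in\{0,1,\dots,m-1\}$ with $\alpha^k(I)=J$. Moreover, for every simple ideal $I$, $$A=I\oplus\alpha(I)\oplus\alpha^2(I)\oplus\cdots\oplus\alpha^{m-1}(I).$$ (2) Conversely, let $(A,\mu')$ be a simple alternative algebra, of finite or infinite dimension, and let $\alpha$ be an automorphism of $(A,\mu')$. Then $(A,\alpha\circ\mu',\alpha)$ is a simple Hom-alternative algebra. -/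

import Mathlib

namespace HomAlt

variable {K A B : Type*} [Field K] [AddCommGroup A] [Module K A] [AddCommGroup B] [Module K B]

/-! A product on `A` is a bilinear map `μ : A →ₗ[K] A →ₗ[K] A`; no associativity, commutativity or
unit is assumed. -/

/-- The Hom-associator `as(x,y,z) = μ(μ(x,y), α(z)) - μ(α(x), μ(y,z))`. -/
def homAssociator (μ : A →ₗ[K] A →ₗ[K] A) (α : A →ₗ[K] A) (x y z : A) : A :=
  μ (μ x y) (α z) - μ (α x) (μ y z)

/-- `(A, μ, α)` is a (multiplicative) Hom-alternative algebra. -/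
structure IsHomAlternative (μ : A →ₗ[K] A →ₗ[K] A) (α : A →ₗ[K] A) : Prop where
  multiplicative : ∀ x y, α (μ x y) = μ (α x) (α y)
  left_alternative : ∀ x y, homAssociator μ α x x y = 0
  right_alternative : ∀ x y, homAssociator μ α x y y = 0

/-- `H` is a two-sided Hom-ideal of `(A, μ, α)`. -/
structure IsHomIdeal (μ : A →ₗ[K] A →ₗ[K] A) (α : A →ₗ[K] A) (H : Submodule K A) : Prop where
  map_mem : ∀ x ∈ H, α x ∈ H
  mul_mem_left : ∀ a, ∀ x ∈ H, μ a x ∈ H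
  mul_mem_right : ∀ a, ∀ x ∈ H, μ x a ∈ H

/-- The derived subspace `μ(A, A)`, i.e. the span of all products. -/
def derived (μ : A →ₗ[K] A →ₗ[K] A) : Submodule K A :=
  Submodule.map₂ μ ⊤ ⊤

/-- `(A, μ, α)` is a simple Hom-alternative algebra. -/
structure IsSimpleHomAlternative (μ : A →ₗ[K] A →ₗ[K] A) (α : A →ₗ[K] A) : Prop where
  isHomAlternative : IsHomAlternative μ α
  twist_ne_zero : α ≠ 0
  derived_ne_bot : derived μ ≠ ⊥
  eq_bot_or_eq_top : ∀ H : Submodule K A, IsHomIdeal μ α H → H = ⊥ ∨ H = ⊤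

/-- `(A, μ)` is an alternative algebra. -/
structure IsAlternative (μ : A →ₗ[K] A →ₗ[K] A) : Prop where
  left_alternative : ∀ x y, μ (μ x x) y = μ x (μ x y)
  right_alternative : ∀ x y, μ (μ x y) y = μ x (μ y y)

/-- `I` is a two-sided ideal of the algebra `(A, μ)`. -/
structure IsIdeal (μ : A →ₗ[K] A →ₗ[K] A) (I : Submodule K A) : Prop where
  mul_mem_left : ∀ a, ∀ x ∈ I, μ a x ∈ I
  mul_mem_right : ∀ a, ∀ x ∈ I, μ x a ∈ I

/-- The algebra `(A, μ)` is simple: its product is not zero and it has no two-sided ideals besides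
`0` and `A`. -/
structure IsSimple (μ : A →ₗ[K] A →ₗ[K] A) : Prop where
  derived_ne_bot : derived μ ≠ ⊥
  eq_bot_or_eq_top : ∀ I : Submodule K A, IsIdeal μ I → I = ⊥ ∨ I = ⊤

/-- The product of `A` restricted to a two-sided ideal `I`, which makes `I` an algebra. -/
def IsIdeal.mul {μ : A →ₗ[K] A →ₗ[K] A} {I : Submodule K A} (h : IsIdeal μ I) :
    I →ₗ[K] I →ₗ[K] I :=
  LinearMap.mk₂ K (fun x y => ⟨μ x y, h.mul_mem_left x y y.2⟩)
    (fun _ _ _ => by ext; simp) (fun _ _ _ => by ext; simp)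
    (fun _ _ _ => by ext; simp) (fun _ _ _ => by ext; simp)

/-- `I` is a simple ideal of `(A, μ)`: a two-sided ideal which, as an algebra in its own right, is
simple. -/
structure IsSimpleIdeal (μ : A →ₗ[K] A →ₗ[K] A) (I : Submodule K A) : Prop where
  isIdeal : IsIdeal μ I
  isSimple : IsSimple isIdeal.mul

/-- `(A, μ)` is semi-simple: it is the direct sum of finitely many simple two-sided ideals. -/
def IsSemisimple (μ : A →ₗ[K] A →ₗ[K] A) : Prop :=
  ∃ (n : ℕ) (I : Fin n → Submodule K A),
    (∀ i, IsSimpleIdeal μ (I i)) ∧ DirectSum.IsInternal I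

/-- The algebras `(A, μ)` and `(B, ν)` are isomorphic. -/
def Isomorphic (μ : A →ₗ[K] A →ₗ[K] A) (ν : B →ₗ[K] B →ₗ[K] B) : Prop :=
  ∃ φ : A ≃ₗ[K] B, ∀ x y, φ (μ x y) = ν (φ x) (φ y)

/-- The linear bijection `e` is an automorphism of the algebra `(A, μ)`. -/
def IsAutomorphism (μ : A →ₗ[K] A →ₗ[K] A) (e : A ≃ₗ[K] A) : Prop :=
  ∀ x y, e (μ x y) = μ (e x) (e y)

/-- The composition `f ∘ μ` of a product with a linear self-map. -/
def twist (f : A →ₗ[K] A) (μ : A →ₗ[K] A →ₗ[K] A) : A →ₗ[K] A →ₗ[K] A :=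
  μ.compr₂ f

end HomAlt

/-!
For the first part, the kernel of `α` is a Hom-ideal, so `α` is bijective, `μ' = α⁻¹ ∘ μ` is
alternative with `α` as an automorphism, and the `α`-stable ideals of `μ'` are Hom-ideals; thus `α`
leaves no proper nonzero ideal stable (`IsSimpleUnder`). In finite dimension there is a minimal
nonzero ideal `I`. The sum of its translates `αᵏ(I)` is stable, hence all of `A`, while distinct
minimal ideals annihilate each other. Since `A` does not annihilate itself, every minimal ideal is
such a translate and has nonzero square, the sum of the minimal ideals is direct, and an ideal of
`I` is an ideal of `A`; so the minimal ideals are the simple ideals. They form one cycle under `α`,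
whose length is the minimal period of `I`.

In the second part, `α(H) = H` for a Hom-ideal `H` of finite dimension, so that `H` is an ideal.
In general `H` contains only some image `αᵏ(x)` of any given `x`, with `k` depending on `x`. A bound
on `k` comes from the nucleus: if `n ≠ 0` associates with all elements, then
`A = K n + n A + A n + (A n) A`, so once `n ∈ H`, two applications of `α` move all of `A` into `H`.

That a simple alternative algebra over a field of characteristic zero has a nonzero nucleus
(`AlternativeRing.exists_ne_zero_associator_eq_zero`) is proved without classification or structure
theory, in three steps.

* Kleinfeld's theorem `associator_commutator_pow_four`: `[x, y]⁴` is always nuclear. It rests on the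
  alternation of Kleinfeld's function and on `[x, y] ∘ (x, y, z) = 0`.
* A simple ring has no trivial element `z ≠ 0`, that is, with `z² = 0` and `z A z = 0`
  (`IsTrivialElement.eq_zero`). Here `(a, b) ↦ (z a)(z b)` and similar maps are skew biderivations,
  and a linear map which kills a nonzero skew biderivation together with its products with single
  elements kills the ideal generated by it (`IsSkewBiderivation.eq_zero_of_kills`).
* If the nucleus is zero, then `[x, y]⁴ = 0`, and an element `x` with `x² = 0` satisfies
  `(L_x L_y)⁴ L_x = 0`. This is lowered by linearization, with the help of the trivial elements,
  to `x = 0`. Hence there are no nilpotent elements, all commutators vanish, and a commutative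
  alternative ring without `3`-torsion is associative, so it is its own nucleus.
-/

/-! ### Associators in alternative rings -/

/-- A non-associative ring in which the alternative laws hold. -/
class AlternativeRing (A : Type*) extends NonUnitalNonAssocRing A where
  left_alt : ∀ x y : A, (x * x) * y = x * (x * y)
  right_alt : ∀ x y : A, (x * y) * y = x * (y * y)

namespace AlternativeRing

variable {A : Type*} [AlternativeRing A]

lemma associator_self_left (x y : A) : associator x x y = 0 :=
  sub_eq_zero.2 (left_alt x y)

lemma associator_self_right (x y : A) : associator x y y = 0 :=
  sub_eq_zero.2 (right_alt x y)

lemma associator_add_left (x x' y z : A) :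
    associator (x + x') y z = associator x y z + associator x' y z := by
  simp only [associator_apply, add_mul]; abel

lemma associator_add_mid (x y y' z : A) :
    associator x (y + y') z = associator x y z + associator x y' z := by
  simp only [associator_apply, add_mul, mul_add]; abel

lemma associator_add_right (x y z z' : A) :
    associator x y (z + z') = associator x y z + associator x y z' := by
  simp only [associator_apply, mul_add]; abel

lemma associator_sub_left (x x' y z : A) :
    associator (x - x') y z = associator x y z - associator x' y z := by
  simp only [associator_apply, sub_mul]; abel

lemma associator_sub_right (x y z z' : A) :
    associator x y (z - z') = associator x y z - associator x y z' := by
  simp only [associator_apply, mul_sub]; abel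

lemma associator_swap_left (x y z : A) : associator y x z = -associator x y z := by
  have h : associator (x + y) (x + y) z = 0 := associator_self_left _ _
  rw [associator_add_left, associator_add_mid, associator_add_mid, associator_self_left,
    associator_self_left] at h
  rw [eq_neg_iff_add_eq_zero, ← h]
  abel

lemma associator_swap_right (x y z : A) : associator x z y = -associator x y z := by
  have h : associator x (y + z) (y + z) = 0 := associator_self_right _ _
  rw [associator_add_right, associator_add_mid, associator_add_mid, associator_self_right,
    associator_self_right] at h
  rw [eq_neg_iff_add_eq_zero, ← h]
  abel

lemma associator_cycle (x y z : A) : associator y z x = associator x y z := by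
  rw [associator_swap_right, associator_swap_left, neg_neg]

lemma associator_self_outer (x y : A) : associator x y x = 0 := by
  rw [associator_cycle, associator_self_left]

/-- The flexible law. -/
lemma flexible (x y : A) : (x * y) * x = x * (y * x) :=
  sub_eq_zero.1 (associator_self_outer x y)

/-- Kleinfeld's function. It measures how far the associator is from being a derivation in its
first argument (with the order of the factors reversed), and it is alternating in all four
arguments. -/
def kleinfeld (w x y z : A) : A :=
  associator (w * x) y z - x * associator w y z - associator x y z * w

lemma kleinfeld_swap_right (w x y z : A) : kleinfeld w x z y = -kleinfeld w x y z := by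
  simp only [kleinfeld, associator_swap_right _ y z, mul_neg, neg_mul]; abel

/-- The Teichmüller identity, rewritten with skew-symmetry of the associator. The right-hand side
changes sign under a cyclic shift of the four arguments, and therefore so does `kleinfeld`; together
with `kleinfeld_swap_right` this makes `kleinfeld` alternating. -/
lemma kleinfeld_cyclic_sum (w x y z : A) :
    kleinfeld w x y z - kleinfeld x y z w + kleinfeld y z w x =
      w * associator x y z - associator x y z * w - (x * associator y z w - associator y z w * x)
        + (y * associator z w x - associator z w x * y)
        - (z * associator w x y - associator w x y * z) := by
  have h := associator_cocycle w x y z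
  rw [← associator_cycle w (x * y) z, associator_cycle (y * z) w x] at h
  simp only [kleinfeld, associator_cycle w y z, associator_cycle x z w, associator_cycle y w x]
    at h ⊢
  linear_combination (norm := abel) -h

lemma kleinfeld_cycle (w x y z : A) : kleinfeld x y z w = -kleinfeld w x y z := by
  have h₁ := kleinfeld_cyclic_sum x y z w
  have h₂ := kleinfeld_cyclic_sum y z w x
  linear_combination (norm := abel) h₁ + h₂

lemma kleinfeld_swap_mid (w x y z : A) : kleinfeld w y x z = -kleinfeld w x y z := by
  rw [kleinfeld_cycle z w y x, kleinfeld_cycle z w x y, kleinfeld_swap_right z w x y]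

lemma kleinfeld_swap_left (w x y z : A) : kleinfeld x w y z = -kleinfeld w x y z := by
  rw [kleinfeld_cycle z x w y, kleinfeld_cycle z w x y, kleinfeld_swap_mid z w x y]

lemma eq_zero_of_add_self [IsAddTorsionFree A] {x : A} (h : x + x = 0) : x = 0 := by
  rw [← two_nsmul] at h
  exact (nsmul_eq_zero_iff_right two_ne_zero).1 h

lemma eq_zero_of_add_add_self [IsAddTorsionFree A] {x : A} (h : x + x + x = 0) : x = 0 := by
  have h3 : 3 • x = 0 := by rw [← h]; abel
  exact (nsmul_eq_zero_iff_right three_ne_zero).1 h3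

lemma kleinfeld_self_right (w x y : A) : kleinfeld w x y y = 0 := by
  simp only [kleinfeld, associator_self_right, mul_zero, zero_mul, sub_zero]

lemma kleinfeld_self_left (x y z : A) : kleinfeld x x y z = 0 := by
  rw [kleinfeld_cycle z x x y, kleinfeld_cycle y z x x, kleinfeld_self_right, neg_zero, neg_zero]

lemma kleinfeld_self_mid (w x z : A) : kleinfeld w x x z = 0 := by
  rw [kleinfeld_cycle z w x x, kleinfeld_self_right, neg_zero]

lemma kleinfeld_self_one_three (x y z : A) : kleinfeld x y x z = 0 := by
  rw [kleinfeld_swap_mid, kleinfeld_self_left, neg_zero]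

lemma associator_mul_self (x y z : A) : associator (x * y) x z = associator y x z * x := by
  have h := kleinfeld_self_one_three x y z
  rw [kleinfeld, associator_self_left, mul_zero, sub_zero] at h
  exact sub_eq_zero.1 h

lemma associator_self_mul (x y z : A) : associator (y * x) x z = x * associator y x z := by
  have h := kleinfeld_self_mid y x z
  rw [kleinfeld, associator_self_left, zero_mul, sub_zero] at h
  exact sub_eq_zero.1 h

lemma associator_right_mul_self (x y z : A) :
    associator x y (x * z) = associator x y z * x := by
  rw [← associator_cycle x y (x * z), ← associator_cycle y (x * z) x, associator_mul_self,
    associator_cycle y z x, associator_cycle x y z]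

lemma associator_right_self_mul (x y z : A) :
    associator x y (z * x) = x * associator x y z := by
  rw [← associator_cycle x y (z * x), ← associator_cycle y (z * x) x, associator_self_mul,
    associator_cycle y z x, associator_cycle x y z]

/-- The left Moufang law. -/
lemma moufang_left (x y z : A) : ((x * y) * x) * z = x * (y * (x * z)) := by
  have h₁ := associator_mul_self x y z
  have h₂ := associator_right_mul_self x y z
  rw [associator_swap_left x y z, neg_mul, ← h₂] at h₁
  simp only [associator_apply] at h₁
  linear_combination (norm := abel) h₁

/-- The middle Moufang law. -/
lemma moufang_mid (x y z : A) : (x * y) * (z * x) = (x * (y * z)) * x := by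
  have h₁ := associator_right_self_mul x y z
  rw [← associator_cycle x y z] at h₁
  simp only [associator_apply, mul_sub] at h₁
  linear_combination (norm := abel) h₁ - flexible x (y * z)

end AlternativeRing

namespace AlternativeRing

variable {A : Type*} [AlternativeRing A]

/-! ### Fourth powers of commutators -/

lemma kleinfeld_add_one (w w' x y z : A) :
    kleinfeld (w + w') x y z = kleinfeld w x y z + kleinfeld w' x y z := by
  simp only [kleinfeld, associator_add_left, add_mul, mul_add]; abel

lemma kleinfeld_add_two (w x x' y z : A) :
    kleinfeld w (x + x') y z = kleinfeld w x y z + kleinfeld w x' y z := by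
  simp only [kleinfeld, associator_add_left, add_mul, mul_add]; abel

lemma associator_mul_self_left (x y z : A) :
    associator (x * x) y z = x * associator x y z + associator x y z * x := by
  have h := kleinfeld_self_left x y z
  rw [kleinfeld] at h
  linear_combination (norm := abel) h

section TorsionFree

variable [IsAddTorsionFree A]

lemma kleinfeld_sq_self (x y z : A) : kleinfeld (x * x) x y z = 0 := by
  have h := kleinfeld_swap_left (x * x) x y z
  apply eq_zero_of_add_self
  have e₁ := left_alt x (associator x y z)
  have e₂ := right_alt (associator x y z) x
  have e₃ := flexible x (associator x y z)
  have e₄ := left_alt x x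
  simp only [kleinfeld, associator_mul_self_left, mul_add, add_mul, e₁, e₂, e₃, e₄] at h ⊢
  linear_combination (norm := abel) h

/-- Linearization of `kleinfeld_sq_self`. -/
lemma kleinfeld_jordan_self (x y z : A) : kleinfeld (x * y + y * x) x y z = 0 := by
  have h := kleinfeld_sq_self (x + y) y z
  have e : (x + y) * (x + y) = x * x + (x * y + y * x) + y * y := by
    simp only [mul_add, add_mul]; abel
  simpa only [e, kleinfeld_add_one, kleinfeld_add_two, kleinfeld_sq_self, kleinfeld_self_mid,
    kleinfeld_swap_mid (y * y) y x, neg_zero, add_zero, zero_add] using h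

/-- A commutator `[x, y]` anticommutes with every associator `(x, y, z)`. -/
lemma commutator_mul_associator (x y z : A) :
    (x * y - y * x) * associator x y z = -(associator x y z * (x * y - y * x)) := by
  have h := kleinfeld_jordan_self x y z
  rw [kleinfeld_add_one, kleinfeld_swap_left x (y * x), kleinfeld, kleinfeld, flexible,
    associator_self_mul, associator_mul_self] at h
  have e₁ := associator_apply x y (associator x y z)
  have e₂ := associator_apply (associator x y z) y x
  have e₃ : associator (associator x y z) y x = -associator x y (associator x y z) := by
    rw [← associator_cycle (associator x y z) y x, associator_swap_left]
  rw [e₁, e₂] at e₃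
  simp only [sub_mul, mul_sub]
  linear_combination (norm := abel) e₃ - h

/-- The square of a commutator `[x, y]` associates with `x` and any third element. -/
lemma associator_commutator_sq_left (x y z : A) :
    associator ((x * y - y * x) * (x * y - y * x)) x z = 0 := by
  have h : associator (x * y - y * x) x z = -associator x y (x * z - z * x) := by
    rw [associator_sub_left, associator_sub_right, associator_mul_self, associator_self_mul,
      associator_right_mul_self, associator_right_self_mul, associator_swap_left x y]
    simp only [neg_mul, mul_neg]
    abel
  rw [associator_mul_self_left, h, mul_neg, commutator_mul_associator, neg_mul, neg_neg,
    add_neg_cancel]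

lemma associator_commutator_sq_right (x y z : A) :
    associator ((x * y - y * x) * (x * y - y * x)) y z = 0 := by
  rw [← associator_commutator_sq_left y x z, ← neg_mul_neg, neg_sub]

end TorsionFree

lemma associator_swap_outer (x y z : A) : associator z y x = -associator x y z := by
  rw [associator_swap_left, associator_cycle]

/-- By alternation `kleinfeld t b w z = -kleinfeld t z w b`, and all associators in the latter
contain both `w` and `b`. -/
lemma kleinfeld_eq_zero_of_associator_eq_zero {w b : A} (h : ∀ z, associator w b z = 0)
    (t z : A) : kleinfeld t b w z = 0 := by
  rw [kleinfeld_swap_right, kleinfeld_swap_mid, kleinfeld_swap_right, kleinfeld,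
    ← associator_cycle (t * z) w b, h, ← associator_cycle t w b, h, ← associator_cycle z w b, h]
  simp

/-- If `w` and `b` associate with every third element, then multiplication by `b` can be moved out of the
skew bilinear map `(t, z) ↦ (t, w, z)`. -/
lemma associator_mul_right_of_associator_eq_zero {w b : A} (h : ∀ z, associator w b z = 0)
    (t z : A) : associator (t * b) w z = b * associator t w z := by
  have e := kleinfeld_eq_zero_of_associator_eq_zero h t z
  rw [kleinfeld, associator_swap_left w b, h, neg_zero, zero_mul, sub_zero] at e
  exact sub_eq_zero.1 e

lemma associator_mul_left_of_associator_eq_zero {w b : A} (h : ∀ z, associator w b z = 0)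
    (t z : A) : associator (b * t) w z = associator t w z * b := by
  have e := kleinfeld_eq_zero_of_associator_eq_zero h t z
  rw [kleinfeld_swap_left, kleinfeld, associator_swap_left w b, h, neg_zero, mul_zero,
    sub_zero] at e
  exact sub_eq_zero.1 (neg_eq_zero.1 e)

/-- If `w` associates with `x` and `y`, then all `(t, w, z)` are annihilated by `[x, y]`: moving
`x` and `y` out of the two arguments in either order gives the same result. -/
lemma commutator_annihilates_associator {w x y : A} (hx : ∀ z, associator w x z = 0)
    (hy : ∀ z, associator w y z = 0) (t z : A) :
    (x * y - y * x) * associator t w z = 0 ∧ associator t w z * (x * y - y * x) = 0 := by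
  have r₁ : ∀ {b : A}, (∀ z, associator w b z = 0) → ∀ t z,
      associator t w (z * b) = b * associator t w z := fun h t z => by
    rw [associator_swap_outer, associator_mul_right_of_associator_eq_zero h,
      associator_swap_outer t, mul_neg, neg_neg]
  have r₂ : ∀ {b : A}, (∀ z, associator w b z = 0) → ∀ t z,
      associator t w (b * z) = associator t w z * b := fun h t z => by
    rw [associator_swap_outer, associator_mul_left_of_associator_eq_zero h,
      associator_swap_outer t, neg_mul, neg_neg]
  have l₁ := @associator_mul_right_of_associator_eq_zero A _ w
  have l₂ := @associator_mul_left_of_associator_eq_zero A _ w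
  have e₁ : x * (y * associator t w z) = y * (x * associator t w z) := by
    rw [← r₁ hy, ← l₁ hx, r₁ hy, l₁ hx]
  have e₂ : (associator t w z * y) * x = (associator t w z * x) * y := by
    rw [← r₂ hy, ← l₂ hx, r₂ hy, l₂ hx]
  have e₃ : associator x (associator t w z) y = 0 := by
    rw [associator_apply, ← r₂ hy, ← l₁ hx, ← l₁ hx, r₂ hy, sub_self]
  have e₄ : associator x y (associator t w z) = 0 := by
    rw [associator_swap_right, e₃, neg_zero]
  have e₅ : associator y x (associator t w z) = 0 := by
    rw [associator_swap_left, e₄, neg_zero]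
  have e₆ : associator (associator t w z) x y = 0 := by
    rw [associator_swap_left, e₃, neg_zero]
  have e₇ : associator (associator t w z) y x = 0 := by
    rw [associator_swap_right, e₆, neg_zero]
  rw [associator_apply, sub_eq_zero] at e₄ e₅ e₆ e₇
  rw [sub_mul, mul_sub, e₄, e₅, ← e₆, ← e₇, e₁, e₂, sub_self, sub_self]
  exact ⟨rfl, rfl⟩

/-- Kleinfeld's theorem: the fourth power of a commutator `v` lies in the nucleus. For `w = v²`,
every `(w, t, z)` is annihilated by `v`, hence by `w`, and
`(w², t, z) = w (w, t, z) + (w, t, z) w`. -/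
theorem associator_commutator_pow_four [IsAddTorsionFree A] {x y v : A} (hv : v = x * y - y * x)
    (t z : A) : associator ((v * v) * (v * v)) t z = 0 := by
  have h : ∀ t, (v * v) * associator t (v * v) z = 0 ∧ associator t (v * v) z * (v * v) = 0 := by
    intro t
    obtain ⟨h₁, h₂⟩ := commutator_annihilates_associator (w := v * v)
      (fun z => hv ▸ associator_commutator_sq_left x y z)
      (fun z => hv ▸ associator_commutator_sq_right x y z) t z
    rw [← hv] at h₁ h₂
    rw [left_alt, h₁, ← right_alt, h₂, mul_zero, zero_mul]
    exact ⟨rfl, rfl⟩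
  rw [associator_mul_self_left, associator_swap_left t, mul_neg, neg_mul, (h t).1, (h t).2,
    neg_zero, add_zero]

end AlternativeRing

namespace AlternativeRing

variable {A : Type*} [AlternativeRing A]

/-! ### Simple rings -/

/-- An additive subgroup which is closed under multiplication by arbitrary elements. -/
structure IsTwoSided (I : AddSubgroup A) : Prop where
  mul_mem_left : ∀ a, ∀ x ∈ I, a * x ∈ I
  mul_mem_right : ∀ a, ∀ x ∈ I, x * a ∈ I

variable (A) in
/-- Simplicity as a ring: the product is not zero and there are no proper nonzero two-sided
ideals, where ideals are only required to be additive subgroups. -/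
class IsSimpleRng : Prop where
  exists_mul_ne_zero : ∃ a b : A, a * b ≠ 0
  eq_bot_or_eq_top : ∀ I : AddSubgroup A, IsTwoSided I → I = ⊥ ∨ I = ⊤

/-- In a simple alternative ring the left annihilator of the whole ring is zero, because it is
an ideal. -/
lemma eq_zero_of_mul_eq_zero [IsSimpleRng A] {z : A} (hz : ∀ a, z * a = 0) : z = 0 := by
  let I : AddSubgroup A :=
    { carrier := {v | ∀ a, v * a = 0}
      zero_mem' := fun a => zero_mul a
      add_mem' := fun {u v} hu hv a => by rw [add_mul, hu a, hv a, add_zero]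
      neg_mem' := fun {u} hu a => by rw [neg_mul, hu a, neg_zero] }
  have hI : IsTwoSided I :=
    { mul_mem_left := fun a x (hx : ∀ b, x * b = 0) b => by
        have e := associator_swap_left x a b
        simp only [associator_apply, hx, zero_mul, sub_zero, mul_zero, neg_zero] at e
        exact e
      mul_mem_right := fun a x (hx : ∀ b, x * b = 0) b => by rw [hx, zero_mul] }
  obtain h | h := IsSimpleRng.eq_bot_or_eq_top I hI
  · exact (AddSubgroup.mem_bot).1 (h ▸ (show z ∈ I from hz))
  · obtain ⟨a, b, hab⟩ := IsSimpleRng.exists_mul_ne_zero (A := A)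
    exact absurd ((h ▸ AddSubgroup.mem_top a : a ∈ I) b) hab

/-! ### Skew biderivations -/

/-- A biadditive map `D` with `D a a = 0` such that all `D a` are derivations. -/
structure IsSkewBiderivation (D : A → A → A) : Prop where
  add_left : ∀ a a' b, D (a + a') b = D a b + D a' b
  add_right : ∀ a b b', D a (b + b') = D a b + D a b'
  self : ∀ a, D a a = 0
  leibniz : ∀ a x y, D a (x * y) = x * D a y + D a x * y

/-- The additive map `W` kills the values of `D` and their products with one element. -/
structure Kills (W : A →+ A) (D : A → A → A) : Prop where
  apply : ∀ a b, W (D a b) = 0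
  mul_left : ∀ a b c, W (c * D a b) = 0
  mul_right : ∀ a b c, W (D a b * c) = 0

namespace IsSkewBiderivation

variable {D : A → A → A} (hD : IsSkewBiderivation D)
include hD

lemma swap (a b : A) : D b a = -D a b := by
  have h := hD.self (a + b)
  rw [hD.add_left, hD.add_right, hD.add_right, hD.self, hD.self, zero_add, add_zero] at h
  exact eq_neg_of_add_eq_zero_right h

/-- The forms `W (c * (d * D a b))` and `W (c * (D a b * d))` agree up to sign and a permutation
of the arguments. Both turn out to be totally skew-symmetric, and applying `W` to
`D a ((c * b) * d)` shows that three times the first one vanishes. -/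
lemma map_mul_mul_eq_zero [IsAddTorsionFree A] {W : A →+ A} (hW : Kills W D) (a b c d : A) :
    W (c * (d * D a b)) = 0 ∧ W (c * (D a b * d)) = 0 := by
  have s₁₂ : ∀ a b c d, W (c * (d * D b a)) = -W (c * (d * D a b)) := fun a b c d => by
    rw [hD.swap a b, mul_neg, mul_neg, map_neg]
  have s₃₄ : ∀ a b c d, W (d * (c * D a b)) = -W (c * (d * D a b)) := fun a b c d => by
    have h := congrArg W (associator_swap_left c d (D a b))
    simp only [associator_apply, map_sub, map_neg, hW.mul_left] at h
    linear_combination (norm := abel) -h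
  have χφ : ∀ a b c d, W (c * (D a b * d)) = -W (c * (b * D a d)) := fun a b c d => by
    have h : W (D a (c * (b * d))) = 0 := hW.apply _ _
    rw [hD.leibniz, hD.leibniz, map_add, hW.mul_right, mul_add, map_add, add_zero] at h
    linear_combination (norm := abel) h
  have s₁₄ : ∀ a b c d, W (c * (a * D d b)) = -W (c * (d * D a b)) := fun a b c d => by
    have h₁ := χφ a d c b
    have h₂ := χφ d a c b
    rw [hD.swap a d, neg_mul, mul_neg, map_neg] at h₂
    linear_combination (norm := abel) h₁ + h₂
  have s₂₄ : ∀ a b c d, W (c * (b * D a d)) = -W (c * (d * D a b)) := fun a b c d => by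
    rw [s₁₂ d a, s₁₄ b, s₁₂ a b, neg_neg]
  have φ0 : ∀ a b c d, W (c * (d * D a b)) = 0 := fun a b c d => by
    -- expanding `W (D a ((c b) d)) = 0`, and moving the products to the standard form by means of
    -- the associator, gives three terms, which all equal `W (c (d (D a b)))`
    have h : W (D a ((c * b) * d)) = 0 := hW.apply _ _
    have h₁ := congrArg W (associator_swap_right c d (D a b))
    have h₂ := congrArg W (associator_cycle (D a c) b d)
    simp only [associator_apply, map_sub, map_neg, hW.mul_left, hW.mul_right, χφ] at h₁ h₂
    rw [hD.leibniz, hD.leibniz, add_mul, map_add, map_add, hW.mul_left] at h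
    rw [s₂₄ a b c d] at h₁
    rw [s₃₄ a c d b, s₂₄ a b d c, s₃₄ a b c d] at h₂
    apply eq_zero_of_add_add_self
    linear_combination (norm := abel) h - h₁ + h₂
  exact ⟨φ0 a b c d, by rw [χφ, φ0, neg_zero]⟩

lemma kills_comp_mulLeft [IsAddTorsionFree A] {W : A →+ A} (hW : Kills W D) (e : A) :
    Kills (W.comp (AddMonoidHom.mulLeft e)) D where
  apply a b := hW.mul_left a b e
  mul_left a b c := (hD.map_mul_mul_eq_zero hW a b e c).1
  mul_right a b c := (hD.map_mul_mul_eq_zero hW a b e c).2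

lemma kills_comp_mulRight [IsAddTorsionFree A] {W : A →+ A} (hW : Kills W D) (e : A) :
    Kills (W.comp (AddMonoidHom.mulRight e)) D where
  apply a b := hW.mul_right a b e
  mul_left a b c := by
    have h := congrArg W (associator_swap_right c e (D a b))
    simp only [associator_apply, map_sub, map_neg, hW.mul_left,
      (hD.map_mul_mul_eq_zero hW a b _ _).1, (hD.map_mul_mul_eq_zero hW a b _ _).2] at h
    simpa using h
  mul_right a b c := by
    have h := congrArg W (associator_cycle (D a b) c e)
    simp only [associator_apply, map_sub, hW.mul_left, hW.mul_right,
      (hD.map_mul_mul_eq_zero hW a b _ _).1] at h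
    simpa using h.symm

/-- In a simple ring, an additive map that kills a nonzero skew biderivation together with its
products with single elements is zero: the elements killed by all these maps form an ideal. -/
lemma eq_zero_of_kills [IsAddTorsionFree A] [IsSimpleRng A] {W : A →+ A} (hW : Kills W D)
    {a b : A} (hab : D a b ≠ 0) : W = 0 := by
  let I : AddSubgroup A :=
    { carrier := {x | ∀ W : A →+ A, Kills W D → W x = 0}
      zero_mem' := fun W _ => map_zero W
      add_mem' := fun {u v} hu hv W h => by rw [map_add, hu W h, hv W h, add_zero]
      neg_mem' := fun {u} hu W h => by rw [map_neg, hu W h, neg_zero] }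
  have hI : IsTwoSided I :=
    { mul_mem_left := fun e x hx W h => hx _ (hD.kills_comp_mulLeft h e)
      mul_mem_right := fun e x hx W h => hx _ (hD.kills_comp_mulRight h e) }
  have hmem : D a b ∈ I := fun W h => h.apply a b
  obtain h | h := IsSimpleRng.eq_bot_or_eq_top I hI
  · exact absurd (AddSubgroup.mem_bot.1 (h ▸ hmem)) hab
  · ext x
    exact (h ▸ AddSubgroup.mem_top x : x ∈ I) W hW

end IsSkewBiderivation

end AlternativeRing

namespace AlternativeRing

variable {A : Type*} [AlternativeRing A]

/-! ### Absolute zero divisors -/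

section Orthogonal

variable {y z : A}

lemma mul_mul_eq_neg_of_orthogonal (hyz : y * z = 0) (hzy : z * y = 0) (x : A) :
    z * (y * x) = -(y * (z * x)) := by
  have h := associator_swap_left y z x
  simp only [associator_apply, hyz, hzy, zero_mul, zero_sub, neg_neg] at h
  rw [← h, neg_neg]

lemma mul_mul_eq_neg_of_orthogonal' (hyz : y * z = 0) (x : A) :
    (x * y) * z = -(y * (z * x)) := by
  have h := associator_cycle x y z
  simp only [associator_apply, hyz, zero_mul, zero_sub, mul_zero, sub_zero] at h
  exact h.symm

/-- If `y z = z y = 0` then `x ↦ y (z x)` is a derivation. -/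
lemma mul_mul_leibniz_of_orthogonal (hyz : y * z = 0) (hzy : z * y = 0) (a b : A) :
    y * (z * (a * b)) = a * (y * (z * b)) + (y * (z * a)) * b := by
  have h : kleinfeld z a b y = kleinfeld z y a b := by
    rw [kleinfeld_swap_right, kleinfeld_swap_mid, neg_neg]
  have e : associator z b y = -(y * (z * b)) := by
    rw [associator_cycle y z b, associator_apply, hyz, zero_mul, zero_sub]
  rw [kleinfeld, kleinfeld, hzy, associator_cycle y (z * a) b, associator_cycle y a b, e] at h
  simp only [associator_apply, zero_mul, sub_self, zero_sub, mul_neg, mul_sub] at h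
  linear_combination (norm := abel) -h

end Orthogonal

/-- A trivial element (an absolute zero divisor): `z² = 0` and `z A z = 0`. -/
structure IsTrivialElement (z : A) : Prop where
  sq : z * z = 0
  mul_mul : ∀ a, (z * a) * z = 0

namespace IsTrivialElement

variable {z : A} (hz : IsTrivialElement z)
include hz

lemma mul_mul' (a : A) : z * (a * z) = 0 := by rw [← flexible, hz.mul_mul]

lemma self_mul_self_mul (a : A) : z * (z * a) = 0 := by
  rw [← left_alt, hz.sq, zero_mul]

lemma mul_self_mul_self (a : A) : (a * z) * z = 0 := by
  rw [right_alt, hz.sq, mul_zero]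

lemma mul_mul_self_mul (a b : A) : z * (a * (z * b)) = 0 := by
  rw [← moufang_left, hz.mul_mul, zero_mul]

lemma isSkewBiderivation_mul_mul :
    IsSkewBiderivation (fun a b => (z * a) * (z * b)) where
  add_left a a' b := by simp only [mul_add, add_mul]
  add_right a b b' := by simp only [mul_add]
  self a := by
    rw [← neg_eq_zero, ← mul_mul_eq_neg_of_orthogonal (hz.mul_mul a) (hz.self_mul_self_mul a),
      right_alt, hz.self_mul_self_mul]
  leibniz a x y :=
    mul_mul_leibniz_of_orthogonal (hz.mul_mul a) (hz.self_mul_self_mul a) x y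

/-- The skew biderivation `(a, b) ↦ (z a)(z b)` vanishes: its values lie in `z A` and in `A z`, so
that left multiplication by `z` kills it, and this map is not zero. -/
lemma mul_mul_eq_zero [IsAddTorsionFree A] [IsSimpleRng A] (a b : A) :
    (z * a) * (z * b) = 0 := by
  by_contra hab
  have hτ : ∀ a b, (z * a) * (z * b) = -(z * ((z * a) * b)) := fun a b => by
    rw [mul_mul_eq_neg_of_orthogonal (hz.mul_mul a) (hz.self_mul_self_mul a), neg_neg]
  have hτ' : ∀ a b, (z * a) * (z * b) = -((b * (z * a)) * z) := fun a b => by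
    rw [mul_mul_eq_neg_of_orthogonal' (hz.mul_mul a), neg_neg]
  have hW : Kills (AddMonoidHom.mulLeft z) (fun a b => (z * a) * (z * b)) :=
    { apply := fun a b => by
        simp only [AddMonoidHom.coe_mulLeft]
        rw [hτ, mul_neg, hz.self_mul_self_mul, neg_zero]
      mul_left := fun a b c => by
        simp only [AddMonoidHom.coe_mulLeft]
        rw [hτ, mul_neg, mul_neg, hz.mul_mul_self_mul, neg_zero]
      mul_right := fun a b c => by
        simp only [AddMonoidHom.coe_mulLeft]
        have h := associator_swap_right z c ((z * a) * (z * b))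
        have h₀ : z * ((z * a) * (z * b)) = 0 := by
          rw [hτ, mul_neg, hz.self_mul_self_mul, neg_zero]
        have h₁ : z * (c * ((z * a) * (z * b))) = 0 := by
          rw [hτ, mul_neg, mul_neg, hz.mul_mul_self_mul, neg_zero]
        have h₂ : (z * c) * ((z * a) * (z * b)) = 0 := by
          rw [hτ', mul_neg, moufang_mid, hz.mul_mul, neg_zero]
        rw [associator_apply, associator_apply, h₀, h₁, h₂, zero_mul, zero_sub, sub_zero,
          neg_zero] at h
        exact neg_eq_zero.1 h }
  have h0 := hz.isSkewBiderivation_mul_mul.eq_zero_of_kills hW hab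
  have : z = 0 := eq_zero_of_mul_eq_zero fun a => by
    rw [← AddMonoidHom.coe_mulLeft, h0, AddMonoidHom.zero_apply]
  simp [this] at hab

lemma mul_self_mul_mul [IsAddTorsionFree A] [IsSimpleRng A] (a b : A) :
    z * ((z * a) * b) = 0 := by
  rw [mul_mul_eq_neg_of_orthogonal (hz.mul_mul a) (hz.self_mul_self_mul a),
    hz.mul_mul_eq_zero, neg_zero]

/-- Left multiplication by a trivial element `z` kills every skew biderivation with values
in `z A`. -/
lemma kills_of_mem_mul [IsAddTorsionFree A] [IsSimpleRng A] {D : A → A → A}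
    (hD : ∀ a b, ∃ c, D a b = z * c) : Kills (AddMonoidHom.mulLeft z) D where
  apply a b := by
    obtain ⟨c, h⟩ := hD a b
    rw [AddMonoidHom.coe_mulLeft, h, hz.self_mul_self_mul]
  mul_left a b e := by
    obtain ⟨c, h⟩ := hD a b
    rw [AddMonoidHom.coe_mulLeft, h, hz.mul_mul_self_mul]
  mul_right a b e := by
    obtain ⟨c, h⟩ := hD a b
    rw [AddMonoidHom.coe_mulLeft, h, hz.mul_self_mul_mul c e]

/-- In a simple ring a nonzero trivial element `z` admits no nonzero skew biderivation with values
in `z A`. -/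
lemma skewBiderivation_eq_zero [IsAddTorsionFree A] [IsSimpleRng A] (hz0 : z ≠ 0)
    {D : A → A → A} (hD : IsSkewBiderivation D) (hDz : ∀ a b, ∃ c, D a b = z * c) (a b : A) :
    D a b = 0 := by
  by_contra hab
  have h0 := hD.eq_zero_of_kills (hz.kills_of_mem_mul hDz) hab
  exact hz0 (eq_zero_of_mul_eq_zero fun a => by
    rw [← AddMonoidHom.coe_mulLeft, h0, AddMonoidHom.zero_apply])

end IsTrivialElement

/-- Multiplication by `z`, from either side, annihilates `y`, `A y` and `y A`. -/
structure Annihilated (z y : A) : Prop where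
  left : z * y = 0
  right : y * z = 0
  left_mul : ∀ a, z * (a * y) = 0
  left_mul' : ∀ a, z * (y * a) = 0
  right_mul : ∀ a, (a * y) * z = 0
  right_mul' : ∀ a, (y * a) * z = 0

namespace Annihilated

variable {z y : A}

/-- The maps `(a, x) ↦ (a y)(z x)` and `(a, x) ↦ (y a)(z x)` are skew biderivations with values in
`z A`, so they vanish. -/
lemma mul_mul_eq_zero [IsAddTorsionFree A] [IsSimpleRng A] (hz : IsTrivialElement z) (hz0 : z ≠ 0)
    (hy : Annihilated z y) (a x : A) :
    (a * y) * (z * x) = 0 ∧ (y * a) * (z * x) = 0 := by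
  constructor
  · refine hz.skewBiderivation_eq_zero hz0 (D := fun a x => (a * y) * (z * x)) ?_ ?_ a x
    · exact
      { add_left := fun a a' b => by simp only [add_mul]
        add_right := fun a b b' => by simp only [mul_add]
        self := fun a => by rw [moufang_mid, hy.right, mul_zero, zero_mul]
        leibniz := fun a => mul_mul_leibniz_of_orthogonal (hy.right_mul a) (hy.left_mul a) }
    · exact fun a x => ⟨-((a * y) * x), by
        rw [mul_neg, mul_mul_eq_neg_of_orthogonal (hy.right_mul a) (hy.left_mul a), neg_neg]⟩
  · refine hz.skewBiderivation_eq_zero hz0 (D := fun a x => (y * a) * (z * x)) ?_ ?_ a x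
    · exact
      { add_left := fun a a' b => by simp only [add_mul, mul_add]
        add_right := fun a b b' => by simp only [mul_add]
        self := fun a => by
          rw [← neg_eq_zero, ← mul_mul_eq_neg_of_orthogonal (hy.right_mul' a) (hy.left_mul' a),
            right_alt, hy.left_mul']
        leibniz := fun a => mul_mul_leibniz_of_orthogonal (hy.right_mul' a) (hy.left_mul' a) }
    · exact fun a x => ⟨-((y * a) * x), by
        rw [mul_neg, mul_mul_eq_neg_of_orthogonal (hy.right_mul' a) (hy.left_mul' a), neg_neg]⟩

section

variable [IsAddTorsionFree A] [IsSimpleRng A] (hz : IsTrivialElement z) (hz0 : z ≠ 0)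
  (hy : Annihilated z y)
include hz hz0 hy

lemma left_mul_mul (a x : A) : z * ((a * y) * x) = 0 := by
  rw [mul_mul_eq_neg_of_orthogonal (hy.right_mul a) (hy.left_mul a),
    (hy.mul_mul_eq_zero hz hz0 a x).1, neg_zero]

lemma right_mul_mul (a x : A) : (x * (a * y)) * z = 0 := by
  rw [mul_mul_eq_neg_of_orthogonal' (hy.right_mul a), (hy.mul_mul_eq_zero hz hz0 a x).1, neg_zero]

lemma left_mul_mul' (a x : A) : z * ((y * a) * x) = 0 := by
  rw [mul_mul_eq_neg_of_orthogonal (hy.right_mul' a) (hy.left_mul' a),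
    (hy.mul_mul_eq_zero hz hz0 a x).2, neg_zero]

lemma right_mul_mul' (a x : A) : (x * (y * a)) * z = 0 := by
  rw [mul_mul_eq_neg_of_orthogonal' (hy.right_mul' a), (hy.mul_mul_eq_zero hz hz0 a x).2,
    neg_zero]

lemma left_mul_mul_mul (a b : A) : z * (b * (y * a)) = 0 := by
  -- `z b` and `y` annihilate each other, which makes `(z b)(y a)` equal to `(a y)(z b) = 0`
  have h₁ : (z * b) * y = 0 := by
    have h := associator_cycle z b y
    simp only [associator_apply, hy.right_mul, hy.right, hy.left_mul, mul_zero, sub_zero] at h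
    exact h.symm
  have h₂ : y * (z * b) = 0 := by
    have h := associator_swap_left z y b
    simp only [associator_apply, hy.right, hy.left, hy.left_mul', zero_mul, sub_zero,
      zero_sub, neg_zero] at h
    exact neg_eq_zero.1 h
  have h₃ : (z * b) * (y * a) = 0 := by
    rw [mul_mul_eq_neg_of_orthogonal h₂ h₁, ← mul_mul_eq_neg_of_orthogonal' h₂,
      (hy.mul_mul_eq_zero hz hz0 a b).1]
  have h := associator_cycle z b (y * a)
  simp only [associator_apply, h₃, hy.right_mul_mul' hz hz0, hy.right_mul', mul_zero,
    sub_zero, zero_sub] at h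
  exact neg_eq_zero.1 h.symm

/-- The mirror image of `left_mul_mul_mul`. -/
lemma mul_mul_right_mul (a b : A) : ((a * y) * b) * z = 0 := by
  have h₁ : (b * z) * y = 0 := by
    have h := associator_swap_right b y z
    simp only [associator_apply, hy.right_mul, hy.right, hy.left, mul_zero, sub_zero,
      neg_zero] at h
    exact h
  have h₂ : y * (b * z) = 0 := by
    have h := associator_cycle z y b
    simp only [associator_apply, hy.right_mul', hy.left, hy.left_mul', zero_mul, sub_zero,
      zero_sub] at h
    exact neg_eq_zero.1 h
  have h₃ : (a * y) * (b * z) = 0 := by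
    rw [mul_mul_eq_neg_of_orthogonal' h₂, ← mul_mul_eq_neg_of_orthogonal h₂ h₁,
      mul_mul_eq_neg_of_orthogonal' (hy.left_mul' a), hy.left_mul_mul' hz hz0, neg_zero]
  have h := associator_cycle z (a * y) b
  simp only [associator_apply, h₃, hy.left_mul_mul hz hz0, hy.left_mul, zero_mul,
    sub_zero] at h
  exact h

lemma mul_left (a : A) : Annihilated z (a * y) where
  left := hy.left_mul a
  right := hy.right_mul a
  left_mul b := by
    have h := congrArg (z * ·) (associator_cycle b a y)
    simp only [associator_apply, mul_sub, hy.left_mul_mul hz hz0, hy.left_mul_mul_mul hz hz0,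
      hy.left_mul, zero_sub, sub_zero] at h
    exact neg_eq_zero.1 h.symm
  left_mul' := hy.left_mul_mul hz hz0 a
  right_mul := hy.right_mul_mul hz hz0 a
  right_mul' := hy.mul_mul_right_mul hz hz0 a

lemma mul_right (a : A) : Annihilated z (y * a) where
  left := hy.left_mul' a
  right := hy.right_mul' a
  left_mul := hy.left_mul_mul_mul hz hz0 a
  left_mul' := hy.left_mul_mul' hz hz0 a
  right_mul := hy.right_mul_mul' hz hz0 a
  right_mul' b := by
    have h := congrArg (· * z) (associator_cycle b y a)
    simp only [associator_apply, sub_mul, hy.mul_mul_right_mul hz hz0,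
      hy.right_mul_mul' hz hz0, hy.right_mul', sub_zero] at h
    exact h

end

end Annihilated

/-- A simple alternative ring contains no nonzero trivial element `z`: otherwise the elements
annihilated by `z` in the sense of `Annihilated` would form an ideal which contains `z`, and `z A`
would be zero. -/
theorem IsTrivialElement.eq_zero [IsAddTorsionFree A] [IsSimpleRng A] {z : A}
    (hz : IsTrivialElement z) : z = 0 := by
  by_contra hz0
  let I : AddSubgroup A :=
    { carrier := {y | Annihilated z y}
      zero_mem' := by constructor <;> simp
      add_mem' := fun {u v} hu hv => by
        constructor <;> intros <;> simp only [mul_add, add_mul, hu.left, hu.right, hu.left_mul,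
          hu.left_mul', hu.right_mul, hu.right_mul', hv.left, hv.right, hv.left_mul,
          hv.left_mul', hv.right_mul, hv.right_mul', add_zero]
      neg_mem' := fun {u} hu => by
        constructor <;> intros <;> simp only [mul_neg, neg_mul, hu.left, hu.right, hu.left_mul,
          hu.left_mul', hu.right_mul, hu.right_mul', neg_zero] }
  have hI : IsTwoSided I :=
    { mul_mem_left := fun a y hy => hy.mul_left hz hz0 a
      mul_mem_right := fun a y hy => hy.mul_right hz hz0 a }
  have hmem : z ∈ I :=
    ⟨hz.sq, hz.sq, hz.mul_mul', hz.self_mul_self_mul, hz.mul_self_mul_self, hz.mul_mul⟩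
  obtain h | h := IsSimpleRng.eq_bot_or_eq_top I hI
  · exact hz0 (AddSubgroup.mem_bot.1 (h ▸ hmem))
  · exact hz0 (eq_zero_of_mul_eq_zero fun a => (h ▸ AddSubgroup.mem_top a : a ∈ I).left)

end AlternativeRing

namespace AlternativeRing

/-! ### Elements of square zero -/

section Ring

variable {R : Type*} [Ring R] {S : AddSubgroup R} {X : R}

/-! The identity `(X Y)ᵏ X = 0` for all `Y` in an additive subgroup is linearized in `Y`; multiplied
by `(X Y)ᵏ⁻¹` from the left, only one term of its linear part in `B` survives. -/

lemma linearize_two (h : ∀ Y ∈ S, (X * Y) ^ 2 * X = 0) {Y B : R} (hY : Y ∈ S) (hB : B ∈ S) :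
    (X * Y * X) * B * (X * Y * X) = 0 := by
  have h₀ := h Y hY
  have h₁ := h _ (S.add_mem hY hB)
  have h₂ := h B hB
  linear_combination (norm := noncomm_ring) X * Y * h₁ - h₀ * B * X - X * Y * h₀ - X * Y * h₂

lemma linearize_three [IsAddTorsionFree R] (h : ∀ Y ∈ S, (X * Y) ^ 3 * X = 0) {Y B : R}
    (hY : Y ∈ S) (hB : B ∈ S) :
    ((X * Y) ^ 2 * X) * B * ((X * Y) ^ 2 * X) = 0 := by
  have h₀ := h Y hY
  have h₁ := h _ (S.add_mem hY hB)
  have h₂ := h _ (S.sub_mem hY hB)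
  have h₃ := h B hB
  have e : 2 • (((X * Y) ^ 2 * X) * B * ((X * Y) ^ 2 * X)) = 0 := by
    linear_combination (norm := noncomm_ring) (X * Y) ^ 2 * (h₁ - h₂) - 2 * (X * Y) ^ 2 * h₃
      - 2 * (h₀ * B * (X * Y * X) + X * Y * h₀ * B * X)
  exact (nsmul_eq_zero_iff_right two_ne_zero).1 e

lemma linearize_four [IsAddTorsionFree R] (h : ∀ Y ∈ S, (X * Y) ^ 4 * X = 0) {Y B : R}
    (hY : Y ∈ S) (hB : B ∈ S) :
    ((X * Y) ^ 3 * X) * B * ((X * Y) ^ 3 * X) = 0 := by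
  have h₀ := h Y hY
  have h₁ := h _ (S.add_mem hY hB)
  have h₂ := h _ (S.sub_mem hY hB)
  have h₃ := h _ (S.add_mem hY (S.add_mem hB hB))
  have h₄ := h _ (S.sub_mem hY (S.add_mem hB hB))
  have e : 12 • (((X * Y) ^ 3 * X) * B * ((X * Y) ^ 3 * X)) = 0 := by
    linear_combination (norm := noncomm_ring) (X * Y) ^ 3 * (8 * (h₁ - h₂) - (h₃ - h₄))
      - 12 * (h₀ * B * ((X * Y) ^ 2 * X) + X * Y * h₀ * B * (X * Y * X)
        + (X * Y) ^ 2 * h₀ * B * X)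
  exact (nsmul_eq_zero_iff_right (by norm_num)).1 e

end Ring

variable {A : Type*} [AlternativeRing A]

/-- Left multiplication by `a`, as an element of the associative ring of additive endomorphisms. -/
def leftMul : A →+ AddMonoid.End A := AddMonoid.End.mulLeft

@[simp]
lemma leftMul_apply (a b : A) : leftMul a b = a * b := rfl

instance [IsAddTorsionFree A] : IsAddTorsionFree (AddMonoid.End A) where
  nsmul_right_injective n hn f g h := by
    ext a
    exact IsAddTorsionFree.nsmul_right_injective hn (DFunLike.congr_fun h a)

lemma leftMul_mul_mul (a b : A) : leftMul (a * b * a) = leftMul a * leftMul b * leftMul a := by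
  ext c
  simp [moufang_left]

lemma leftMul_mul_self (a : A) : leftMul (a * a) = leftMul a * leftMul a := by
  ext c
  simp [left_alt]

lemma leftMul_mul_of_associator_eq_zero {a b : A} (h : ∀ c, associator a b c = 0) :
    leftMul (a * b) = leftMul a * leftMul b := by
  ext c
  exact sub_eq_zero.1 (h c)

section Simple

variable [IsSimpleRng A]

lemma leftMul_injective : Function.Injective (leftMul : A → AddMonoid.End A) :=
  (injective_iff_map_eq_zero leftMul).2 fun _ h =>
    eq_zero_of_mul_eq_zero fun b => DFunLike.congr_fun h b

lemma leftMul_eq_zero {a : A} : leftMul a = 0 ↔ a = 0 :=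
  map_eq_zero_iff _ leftMul_injective

/-- An element `u` is trivial as soon as the left multiplication by `u` is trivial among the left
multiplications. -/
lemma eq_zero_of_leftMul [IsAddTorsionFree A] {u : A} (h : leftMul u * leftMul u = 0)
    (h' : ∀ a, leftMul u * leftMul a * leftMul u = 0) : u = 0 :=
  IsTrivialElement.eq_zero
    { sq := leftMul_eq_zero.1 (by rw [leftMul_mul_self, h])
      mul_mul := fun a => leftMul_eq_zero.1 (by rw [leftMul_mul_mul, h']) }

/-- If all commutators are nilpotent of index four, then there are no nonzero elements of square
zero. For `x² = 0` and `w = [x, y]²`, left multiplication by `w x = x w` is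
`(L_x L_y)² L_x = L_w L_x = L_x L_w`; hence `(L_x L_y)⁴ L_x = 0`. Linearizing in `y`, the exponent
is lowered step by step, each time because a trivial element vanishes. -/
lemma eq_zero_of_sq_eq_zero [IsAddTorsionFree A]
    (hv : ∀ x y v : A, v = x * y - y * x → (v * v) * (v * v) = 0) {x : A} (hx : x * x = 0) :
    x = 0 := by
  have hX : leftMul x * leftMul x = 0 := by rw [← leftMul_mul_self, hx, map_zero]
  have h₄ : ∀ y, (leftMul x * leftMul y) ^ 4 * leftMul x = 0 := by
    intro y
    obtain ⟨v, hvxy⟩ : ∃ v, v = x * y - y * x := ⟨_, rfl⟩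
    have e₁ : v * x = x * y * x := by
      rw [hvxy, sub_mul, right_alt y, hx, mul_zero, sub_zero]
    have e₂ : x * v = -(x * y * x) := by
      rw [hvxy, mul_sub, ← left_alt, hx, zero_mul, zero_sub, flexible]
    have e₃ : v * v * x = x * (y * x * y) * x := by
      have h : (y * x) * (x * (y * x)) = 0 := by
        rw [← flexible, right_alt y, hx, mul_zero, zero_mul]
      rw [left_alt, e₁]
      nth_rw 1 [hvxy]
      rw [sub_mul, flexible x y, h, sub_zero, ← flexible x y, moufang_mid, flexible y]
    have e₄ : x * (v * v) = v * v * x := by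
      rw [← right_alt, e₂, neg_mul, ← e₁, flexible, e₂, mul_neg, neg_neg, ← e₁,
        left_alt]
    have hxw : ∀ c, associator (v * v) x c = 0 := fun c =>
      hvxy ▸ associator_commutator_sq_left x y c
    have hwx : ∀ c, associator x (v * v) c = 0 := fun c => by
      rw [associator_swap_left, hxw, neg_zero]
    have e₅ : leftMul (v * v * x) = leftMul x * leftMul y * leftMul x * leftMul y * leftMul x := by
      rw [e₃, leftMul_mul_mul, leftMul_mul_mul]
      simp only [mul_assoc]
    have e₆ := leftMul_mul_of_associator_eq_zero hxw
    have e₇ := leftMul_mul_of_associator_eq_zero hwx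
    rw [e₄] at e₇
    have e₈ : leftMul (v * v) * leftMul (v * v) = 0 := by
      rw [← leftMul_mul_self, hv x y v hvxy, map_zero]
    calc (leftMul x * leftMul y) ^ 4 * leftMul x
        = leftMul x * leftMul y * leftMul x * leftMul y *
          (leftMul x * leftMul y * leftMul x * leftMul y * leftMul x) := by noncomm_ring
      _ = leftMul x * leftMul y * leftMul x * leftMul y * (leftMul x * leftMul (v * v)) := by
          rw [← e₅, e₇]
      _ = (leftMul x * leftMul y * leftMul x * leftMul y * leftMul x) * leftMul (v * v) := by
          simp only [mul_assoc]
      _ = 0 := by rw [← e₅, e₇, mul_assoc, e₈, mul_zero]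
  have hS : ∀ {k : ℕ}, (∀ y : A, (leftMul x * leftMul y) ^ k * leftMul x = 0) →
      ∀ Y ∈ (leftMul : A →+ AddMonoid.End A).range, (leftMul x * Y) ^ k * leftMul x = 0 := by
    rintro k h _ ⟨y, rfl⟩
    exact h y
  have hsq : ∀ (k : ℕ) (y : A), ((leftMul x * leftMul y) ^ (k + 1) * leftMul x) *
      ((leftMul x * leftMul y) ^ (k + 1) * leftMul x) = 0 := fun k y => by
    calc _ = (leftMul x * leftMul y) ^ (k + 1) * ((leftMul x * leftMul x) * leftMul y *
          (leftMul x * leftMul y) ^ k * leftMul x) := by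
          nth_rw 2 [pow_succ']
          simp only [mul_assoc]
      _ = 0 := by simp [hX]
  have h₃ : ∀ y, (leftMul x * leftMul y) ^ 3 * leftMul x = 0 := fun y => by
    have e : leftMul (x * (y * (x * y * x) * y) * x) =
        (leftMul x * leftMul y) ^ 3 * leftMul x := by
      simp only [leftMul_mul_mul]; noncomm_ring
    rw [← e, leftMul_eq_zero]
    apply eq_zero_of_leftMul
    · rw [e, hsq]
    · intro a
      rw [e, linearize_four (hS h₄) ⟨y, rfl⟩ ⟨a, rfl⟩]
  have h₂ : ∀ y, (leftMul x * leftMul y) ^ 2 * leftMul x = 0 := fun y => by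
    have e : leftMul (x * (y * x * y) * x) = (leftMul x * leftMul y) ^ 2 * leftMul x := by
      simp only [leftMul_mul_mul]; noncomm_ring
    rw [← e, leftMul_eq_zero]
    apply eq_zero_of_leftMul
    · rw [e, hsq]
    · intro a
      rw [e, linearize_three (hS h₃) ⟨y, rfl⟩ ⟨a, rfl⟩]
  have h₁ : ∀ y, x * y * x = 0 := fun y => by
    have e : leftMul (x * y * x) = leftMul x * leftMul y * leftMul x := leftMul_mul_mul x y
    apply eq_zero_of_leftMul
    · rw [e]
      simpa using hsq 0 y
    · intro a
      rw [e, linearize_two (hS h₂) ⟨y, rfl⟩ ⟨a, rfl⟩]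
  exact IsTrivialElement.eq_zero ⟨hx, h₁⟩

/-- A simple alternative ring without torsion has a nonzero nucleus. If the nucleus were zero, all
commutators would have vanishing fourth power. Then there would be no nonzero nilpotent elements,
so all commutators would vanish; but a commutative alternative ring without `3`-torsion is
associative. -/
theorem exists_ne_zero_associator_eq_zero [IsAddTorsionFree A] :
    ∃ n : A, n ≠ 0 ∧ ∀ a b, associator n a b = 0 := by
  by_contra! hN
  replace hN : ∀ n : A, (∀ a b, associator n a b = 0) → n = 0 := fun n h => by
    by_contra hn
    obtain ⟨a, b, hab⟩ := hN n hn
    exact hab (h a b)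
  have hnil : ∀ {x : A}, x * x = 0 → x = 0 := eq_zero_of_sq_eq_zero fun x y v hv =>
    hN _ (associator_commutator_pow_four hv)
  have hcomm : ∀ x y : A, x * y = y * x := fun x y =>
    sub_eq_zero.1 (hnil (hnil (hN _ (associator_commutator_pow_four rfl))))
  have hassoc : ∀ x y z : A, associator x y z = 0 := fun x y z => by
    have h₁ := associator_cycle x y z
    have h₂ := associator_cycle y z x
    apply eq_zero_of_add_add_self
    simp only [associator_apply] at h₁ h₂ ⊢
    have h₃ := hcomm (x * y) z
    have h₄ := hcomm (y * z) x
    have h₅ := hcomm (z * x) y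
    linear_combination (norm := abel) h₃ + h₄ + h₅ - h₁ - h₁ - h₂
  obtain ⟨a, b, hab⟩ := IsSimpleRng.exists_mul_ne_zero (A := A)
  exact hab (by rw [hN a (hassoc a), zero_mul])

end Simple

end AlternativeRing

/-! ### Twists of simple alternative algebras -/

namespace HomAlt

variable {K A : Type*} [Field K] [AddCommGroup A] [Module K A]

/-- The alternative ring structure on `A` given by an alternative bilinear product. -/
@[reducible]
def IsAlternative.alternativeRing {μ : A →ₗ[K] A →ₗ[K] A} (h : IsAlternative μ) :
    AlternativeRing A where
  mul x y := μ x y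
  left_distrib x y z := map_add (μ x) y z
  right_distrib x y z := μ.map_add₂ x y z
  zero_mul := μ.map_zero₂
  mul_zero x := map_zero (μ x)
  left_alt := h.left_alternative
  right_alt := h.right_alternative

lemma derived_eq_span (μ : A →ₗ[K] A →ₗ[K] A) :
    derived μ = Submodule.span K {x | ∃ a b, μ a b = x} := by
  rw [derived, Submodule.map₂_eq_span_image2]
  congr 1
  ext x
  simp [Set.mem_image2]

lemma mul_mem_derived (μ : A →ₗ[K] A →ₗ[K] A) (a b : A) : μ a b ∈ derived μ :=
  Submodule.apply_mem_map₂ μ trivial trivial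

lemma derived_ne_bot_iff {μ : A →ₗ[K] A →ₗ[K] A} : derived μ ≠ ⊥ ↔ ∃ a b, μ a b ≠ 0 := by
  constructor
  · intro h
    by_contra! h'
    exact h (le_bot_iff.1 (Submodule.map₂_le.2 fun a _ b _ => (Submodule.mem_bot K).2 (h' a b)))
  · rintro ⟨a, b, hab⟩ h
    exact hab ((Submodule.mem_bot K).1 (h ▸ mul_mem_derived μ a b))

lemma IsSimple.derived_eq_top {μ : A →ₗ[K] A →ₗ[K] A} (h : IsSimple μ) : derived μ = ⊤ :=
  (h.eq_bot_or_eq_top _ ⟨fun a x _ => mul_mem_derived μ a x,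
    fun a x _ => mul_mem_derived μ x a⟩).resolve_left h.derived_ne_bot

/-- A simple algebra is simple as a ring: an ideal of the ring which is nonzero spans `A` over `K`,
and therefore it contains all products, which also span `A`. -/
lemma IsSimple.isSimpleRng {μ : A →ₗ[K] A →ₗ[K] A} (h : IsSimple μ) (ha : IsAlternative μ) :
    @AlternativeRing.IsSimpleRng A ha.alternativeRing := by
  let _ := ha.alternativeRing
  refine ⟨derived_ne_bot_iff.1 h.derived_ne_bot, fun I hI => ?_⟩
  have hl : ∀ a, ∀ x ∈ I, μ a x ∈ I := hI.mul_mem_left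
  have hr : ∀ a, ∀ x ∈ I, μ x a ∈ I := hI.mul_mem_right
  have hspan : IsIdeal μ (Submodule.span K (I : Set A)) := by
    constructor <;> intro a x hx
    · have : Submodule.span K (I : Set A) ≤ (Submodule.span K (I : Set A)).comap (μ a) :=
        Submodule.span_le.2 fun y hy => Submodule.subset_span (hl a y hy)
      exact this hx
    · have : Submodule.span K (I : Set A) ≤ (Submodule.span K (I : Set A)).comap (μ.flip a) :=
        Submodule.span_le.2 fun y hy => Submodule.subset_span (hr a y hy)
      exact this hx
  obtain hJ | hJ := h.eq_bot_or_eq_top _ hspan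
  · left
    exact (AddSubgroup.eq_bot_iff_forall I).2 fun x hx => Submodule.span_eq_bot.1 hJ x hx
  · right
    have hmul : ∀ b a, μ a b ∈ I := fun b => by
      have hb : b ∈ Submodule.span K (I : Set A) := hJ ▸ Submodule.mem_top
      induction hb using Submodule.span_induction with
      | mem x hx => exact fun a => hl a x hx
      | zero => exact fun a => by rw [map_zero]; exact I.zero_mem
      | add x y _ _ hx hy => exact fun a => by rw [map_add]; exact I.add_mem (hx a) (hy a)
      | smul c x _ hx =>
        intro a
        rw [map_smul, ← LinearMap.map_smul₂]
        exact hx (c • a)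
    refine (AddSubgroup.eq_top_iff' I).2 fun x => ?_
    have hx : x ∈ Submodule.span K {x | ∃ a b, μ a b = x} :=
      derived_eq_span μ ▸ h.derived_eq_top ▸ Submodule.mem_top
    suffices ∀ c : K, c • x ∈ I by simpa using this 1
    induction hx using Submodule.span_induction with
    | mem x hx =>
      obtain ⟨a, b, rfl⟩ := hx
      exact fun c => by rw [← LinearMap.map_smul₂]; exact hmul b (c • a)
    | zero => exact fun c => by rw [smul_zero]; exact I.zero_mem
    | add x y _ _ hx hy => exact fun c => by rw [smul_add]; exact I.add_mem (hx c) (hy c)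
    | smul c x _ hx => exact fun d => by rw [smul_smul]; exact hx (d * c)

lemma isAddTorsionFree (K A : Type*) [Field K] [CharZero K] [AddCommGroup A] [Module K A] :
    IsAddTorsionFree A where
  nsmul_right_injective n hn x y h := by
    have h' : (n : K) • x = (n : K) • y := by simpa only [Nat.cast_smul_eq_nsmul] using h
    exact smul_right_injective A (Nat.cast_ne_zero.2 hn : (n : K) ≠ 0) h'

/-- Over a field of characteristic zero, a simple alternative algebra of any dimension has a nonzero
nuclear element. -/
theorem IsSimple.exists_nuclear [CharZero K] {μ : A →ₗ[K] A →ₗ[K] A} (h : IsSimple μ)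
    (ha : IsAlternative μ) : ∃ n, n ≠ 0 ∧ ∀ x y, μ (μ n x) y = μ n (μ x y) := by
  let _ := ha.alternativeRing
  have := h.isSimpleRng ha
  have := isAddTorsionFree K A
  obtain ⟨n, hn, hassoc⟩ := AlternativeRing.exists_ne_zero_associator_eq_zero (A := A)
  exact ⟨n, hn, fun x y => sub_eq_zero.1 (hassoc x y)⟩

/-- The span of `n`, `n A`, `A n` and `(A n) A`. -/
def nuclearIdeal (μ : A →ₗ[K] A →ₗ[K] A) (n : A) : Submodule K A :=
  Submodule.span K {n} ⊔ LinearMap.range (μ n) ⊔ LinearMap.range (μ.flip n) ⊔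
    Submodule.map₂ μ (LinearMap.range (μ.flip n)) ⊤

lemma mem_nuclearIdeal (μ : A →ₗ[K] A →ₗ[K] A) (n : A) : n ∈ nuclearIdeal μ n :=
  (le_sup_left.trans (le_sup_left.trans le_sup_left) : Submodule.span K {n} ≤ nuclearIdeal μ n)
    (Submodule.mem_span_singleton_self n)

lemma nuclearIdeal_le {μ : A →ₗ[K] A →ₗ[K] A} {n : A} {P : Submodule K A} (h₁ : n ∈ P)
    (h₂ : ∀ a, μ n a ∈ P) (h₃ : ∀ a, μ a n ∈ P) (h₄ : ∀ a b, μ (μ a n) b ∈ P) :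
    nuclearIdeal μ n ≤ P := by
  refine sup_le (sup_le (sup_le ?_ ?_) ?_) (Submodule.map₂_le.2 ?_)
  · simpa using h₁
  · rintro _ ⟨a, rfl⟩
    exact h₂ a
  · rintro _ ⟨a, rfl⟩
    exact h₃ a
  · rintro _ ⟨a, rfl⟩ b _
    exact h₄ a b

/-- For a nuclear element `n`, products of any length with the factor `n` are sums of products with
at most two further factors. -/
lemma isIdeal_nuclearIdeal {μ : A →ₗ[K] A →ₗ[K] A} (ha : IsAlternative μ) {n : A}
    (hn : ∀ x y, μ (μ n x) y = μ n (μ x y)) : IsIdeal μ (nuclearIdeal μ n) := by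
  set P := nuclearIdeal μ n with hP
  have m₁ : n ∈ P := mem_nuclearIdeal μ n
  have m₂ : ∀ a, μ n a ∈ P := fun a =>
    (le_sup_right.trans (le_sup_left.trans le_sup_left) : _ ≤ P) (LinearMap.mem_range_self _ a)
  have m₃ : ∀ a, μ a n ∈ P := fun a =>
    (le_sup_right.trans le_sup_left : _ ≤ P) (LinearMap.mem_range_self (μ.flip n) a)
  have m₄ : ∀ a b, μ (μ a n) b ∈ P := fun a b =>
    (le_sup_right : _ ≤ P)
      (Submodule.apply_mem_map₂ μ (LinearMap.mem_range_self (μ.flip n) a) trivial)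
  let _ := ha.alternativeRing
  have hn₁ : ∀ x y, associator n x y = 0 := fun x y => sub_eq_zero.2 (hn x y)
  have hn₂ : ∀ x y, associator x n y = 0 := fun x y => by
    rw [AlternativeRing.associator_swap_left, hn₁, neg_zero]
  have hn₃ : ∀ x y, associator x y n = 0 := fun x y => by
    rw [← AlternativeRing.associator_cycle, hn₂]
  have e₂ : ∀ x y, (x * n) * y = x * (n * y) := fun x y => sub_eq_zero.1 (hn₂ x y)
  have e₃ : ∀ x y, (x * y) * n = x * (y * n) := fun x y => sub_eq_zero.1 (hn₃ x y)
  have e₄ : ∀ x y c, associator (n * c) x y = n * associator c x y := fun x y c => by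
    have h := associator_cocycle n c x y
    rw [hn₁, hn₁, hn₁, zero_mul] at h
    linear_combination (norm := abel) -h
  have hl : ∀ a x, x ∈ P → a * x ∈ P := fun a => by
    refine fun x hx => (nuclearIdeal_le (P := P.comap (μ a)) ?_ ?_ ?_ ?_ : _ ≤ _) hx
    · exact m₃ a
    · intro b
      change a * (n * b) ∈ P
      rw [← e₂]
      exact m₄ a b
    · intro b
      change a * (b * n) ∈ P
      rw [← e₃]
      exact m₃ (a * b)
    · intro b c
      have h₁ : a * ((b * n) * c) = ((a * b) * n) * c - n * associator c a b := by
        rw [← e₄, ← AlternativeRing.associator_cycle (n * c) a b, associator_apply, e₂, e₂]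
        abel
      change a * ((b * n) * c) ∈ P
      rw [h₁]
      exact P.sub_mem (m₄ _ _) (m₂ _)
  have hr : ∀ a x, x ∈ P → x * a ∈ P := fun a => by
    refine fun x hx => (nuclearIdeal_le (P := P.comap (μ.flip a)) ?_ ?_ ?_ ?_ : _ ≤ _) hx
    · exact m₂ a
    · intro b
      change n * b * a ∈ P
      rw [show n * b * a = n * (b * a) from hn b a]
      exact m₂ (b * a)
    · exact fun b => m₄ b a
    · intro b c
      have h₁ : ((b * n) * c) * a = (b * n) * (c * a) + n * associator c a b := by
        have h := associator_cocycle b n c a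
        rw [hn₁, hn₂, hn₂, zero_mul, mul_zero, ← AlternativeRing.associator_cycle b (n * c) a,
          e₄, associator_apply (b * n)] at h
        linear_combination (norm := abel) -h
      change ((b * n) * c) * a ∈ P
      rw [h₁]
      exact P.add_mem (m₄ _ _) (m₂ _)
  exact ⟨hl, hr⟩

lemma IsSimple.nuclearIdeal_eq_top {μ : A →ₗ[K] A →ₗ[K] A} (h : IsSimple μ)
    (ha : IsAlternative μ) {n : A} (hn0 : n ≠ 0) (hn : ∀ x y, μ (μ n x) y = μ n (μ x y)) :
    nuclearIdeal μ n = ⊤ := by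
  refine (h.eq_bot_or_eq_top _ (isIdeal_nuclearIdeal ha hn)).resolve_left fun h0 => hn0 ?_
  exact (Submodule.mem_bot K).1 (h0 ▸ mem_nuclearIdeal μ n)

/-- The twist of a simple alternative algebra by an automorphism has no proper nonzero Hom-ideals.
Every element is moved into a given Hom-ideal `H` by some power of the automorphism; if `n` is a
nuclear element in `H`, two more applications move `A = K n + n A + A n + (A n) A` into `H`. -/
lemma IsSimple.eq_bot_or_eq_top_of_isHomIdeal [CharZero K] {μ : A →ₗ[K] A →ₗ[K] A}
    (h : IsSimple μ) (ha : IsAlternative μ) {e : A ≃ₗ[K] A} (he : IsAutomorphism μ e)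
    {H : Submodule K A} (hH : IsHomIdeal (twist (e : A →ₗ[K] A) μ) e H) : H = ⊥ ∨ H = ⊤ := by
  have hmap : ∀ x ∈ H, e x ∈ H := hH.map_mem
  have hl : ∀ a, ∀ x ∈ H, e (μ a x) ∈ H := hH.mul_mem_left
  have hr : ∀ a, ∀ x ∈ H, e (μ x a) ∈ H := hH.mul_mem_right
  have hiter : ∀ (k j : ℕ) (x : A), e^[k] x ∈ H → e^[k + j] x ∈ H := by
    intro k j x hx
    induction j with
    | zero => exact hx
    | succ j ih => rw [← add_assoc, Function.iterate_succ_apply']; exact hmap _ ih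
  have hmul : ∀ (k : ℕ) (x y : A), e^[k] (μ x y) = μ (e^[k] x) (e^[k] y) := by
    intro k x y
    induction k with
    | zero => rfl
    | succ k ih => simp only [Function.iterate_succ_apply', ih, he _ _]
  have hsmul : ∀ (k : ℕ) (c : K) (x : A), e^[k] (c • x) = c • e^[k] x := by
    intro k c x
    induction k with
    | zero => rfl
    | succ k ih => simp only [Function.iterate_succ_apply', ih, map_smul]
  let U : Submodule K A :=
    { carrier := {x | ∃ k : ℕ, e^[k] x ∈ H}
      zero_mem' := ⟨0, H.zero_mem⟩
      add_mem' := by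
        rintro x y ⟨k, hx⟩ ⟨j, hy⟩
        refine ⟨k + j, ?_⟩
        rw [iterate_map_add]
        exact H.add_mem (hiter k j x hx) (add_comm j k ▸ hiter j k y hy)
      smul_mem' := by
        rintro c x ⟨k, hx⟩
        refine ⟨k, ?_⟩
        rw [hsmul]
        exact H.smul_mem c hx }
  have hU : IsIdeal μ U := by
    constructor
    · rintro a x ⟨k, hx⟩
      refine ⟨k + 1, ?_⟩
      rw [Function.iterate_succ_apply', hmul]
      exact hl _ _ hx
    · rintro a x ⟨k, hx⟩
      refine ⟨k + 1, ?_⟩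
      rw [Function.iterate_succ_apply', hmul]
      exact hr _ _ hx
  obtain hU | hU := h.eq_bot_or_eq_top U hU
  · left
    refine (Submodule.eq_bot_iff H).2 fun x hx => ?_
    exact (Submodule.mem_bot K).1 (hU ▸ (⟨0, hx⟩ : x ∈ U))
  · right
    obtain ⟨n, hn0, hn⟩ := h.exists_nuclear ha
    obtain ⟨k, hk⟩ : n ∈ U := hU ▸ Submodule.mem_top
    have hn0' : e^[k] n ≠ 0 := by
      rw [← iterate_map_zero e k]
      exact (e.injective.iterate k).ne hn0
    have hn' : ∀ x y, μ (μ (e^[k] n) x) y = μ (e^[k] n) (μ x y) := by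
      intro x y
      obtain ⟨x, rfl⟩ := (e.surjective.iterate k) x
      obtain ⟨y, rfl⟩ := (e.surjective.iterate k) y
      simp only [← hmul, hn]
    have htop := h.nuclearIdeal_eq_top ha hn0' hn'
    refine Submodule.eq_top_iff'.2 fun x => ?_
    obtain ⟨x, rfl⟩ := e.surjective x
    obtain ⟨x, rfl⟩ := e.surjective x
    have hx : x ∈ nuclearIdeal μ (e^[k] n) := htop ▸ Submodule.mem_top
    refine (nuclearIdeal_le (P := (H.comap (e : A →ₗ[K] A)).comap (e : A →ₗ[K] A))
      ?_ ?_ ?_ ?_ : _ ≤ _) hx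
    · exact hmap _ (hmap _ hk)
    · exact fun a => hmap _ (hr a _ hk)
    · exact fun a => hmap _ (hl a _ hk)
    · intro a b
      change e (e (μ (μ a _) b)) ∈ H
      rw [he]
      exact hr _ _ (hl a _ hk)

/-- Twisting a simple alternative algebra by an automorphism gives a simple Hom-alternative
algebra. -/
theorem IsSimple.isSimpleHomAlternative_twist [CharZero K] {μ : A →ₗ[K] A →ₗ[K] A}
    (h : IsSimple μ) (ha : IsAlternative μ) {e : A ≃ₗ[K] A} (he : IsAutomorphism μ e) :
    IsSimpleHomAlternative (twist (e : A →ₗ[K] A) μ) (e : A →ₗ[K] A) := by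
  obtain ⟨a, b, hab⟩ := derived_ne_bot_iff.1 h.derived_ne_bot
  refine ⟨⟨fun x y => ?_, fun x y => ?_, fun x y => ?_⟩, fun h0 => ?_, ?_, fun H hH =>
    h.eq_bot_or_eq_top_of_isHomIdeal ha he hH⟩
  · simp [twist, he _ _]
  · simp [homAssociator, twist, ← he _ _, ha.left_alternative]
  · simp [homAssociator, twist, ← he _ _, ha.right_alternative]
  · exact hab (e.injective (by simpa using LinearMap.congr_fun h0 (μ a b)))
  · exact derived_ne_bot_iff.2 ⟨a, b, by simpa [twist] using hab⟩

end HomAlt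

/-! ### Minimal ideals and automorphisms -/

namespace HomAlt

variable {K A : Type*} [Field K] [AddCommGroup A] [Module K A]

/-- `I` is minimal among the nonzero two-sided ideals of `(A, μ)`. -/
structure IsMinimalIdeal (μ : A →ₗ[K] A →ₗ[K] A) (I : Submodule K A) : Prop where
  isIdeal : IsIdeal μ I
  ne_bot : I ≠ ⊥
  eq_bot_or_eq : ∀ J, IsIdeal μ J → J ≤ I → J = ⊥ ∨ J = I

/-- `e` is an automorphism of `(A, μ)`, the product is not zero, and the only ideals mapped into
themselves by `e` are `0` and `A`. -/
structure IsSimpleUnder (μ : A →ₗ[K] A →ₗ[K] A) (e : A ≃ₗ[K] A) : Prop where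
  isAutomorphism : IsAutomorphism μ e
  derived_ne_bot : derived μ ≠ ⊥
  eq_bot_or_eq_top : ∀ I, IsIdeal μ I → I.map (e : A →ₗ[K] A) ≤ I → I = ⊥ ∨ I = ⊤

variable {μ : A →ₗ[K] A →ₗ[K] A} {e : A ≃ₗ[K] A} {I J : Submodule K A}

lemma IsAutomorphism.symm (he : IsAutomorphism μ e) : IsAutomorphism μ e.symm := fun x y => by
  rw [e.symm_apply_eq, he, e.apply_symm_apply, e.apply_symm_apply]

lemma IsAutomorphism.pow (he : IsAutomorphism μ e) (k : ℕ) : IsAutomorphism μ (e ^ k) := by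
  induction k with
  | zero => exact fun x y => rfl
  | succ k ih => exact fun x y => by simp only [pow_succ', LinearEquiv.mul_apply, ih x y, he _ _]

lemma coe_pow_linearEquiv (e : A ≃ₗ[K] A) (k : ℕ) :
    ((e ^ k : A ≃ₗ[K] A) : A →ₗ[K] A) = (e : A →ₗ[K] A) ^ k := by
  induction k with
  | zero => rfl
  | succ k ih => rw [pow_succ', pow_succ', ← ih]; rfl

lemma map_pow_eq_iterate (α : A →ₗ[K] A) (k : ℕ) (I : Submodule K A) :
    I.map (α ^ k) = (Submodule.map α)^[k] I := by
  induction k with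
  | zero => exact Submodule.map_id I
  | succ k ih =>
    rw [Function.iterate_succ_apply', ← ih, pow_succ', Module.End.mul_eq_comp, Submodule.map_comp]

lemma IsIdeal.map (he : IsAutomorphism μ e) (hI : IsIdeal μ I) :
    IsIdeal μ (I.map (e : A →ₗ[K] A)) := by
  constructor
  · rintro a _ ⟨x, hx, rfl⟩
    exact ⟨μ (e.symm a) x, hI.mul_mem_left _ x hx, by simp [he _ _]⟩
  · rintro a _ ⟨x, hx, rfl⟩
    exact ⟨μ x (e.symm a), hI.mul_mem_right _ x hx, by simp [he _ _]⟩

lemma IsIdeal.inf (hI : IsIdeal μ I) (hJ : IsIdeal μ J) : IsIdeal μ (I ⊓ J) :=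
  ⟨fun a x hx => ⟨hI.mul_mem_left a x hx.1, hJ.mul_mem_left a x hx.2⟩,
    fun a x hx => ⟨hI.mul_mem_right a x hx.1, hJ.mul_mem_right a x hx.2⟩⟩

lemma IsIdeal.sSup {S : Set (Submodule K A)} (hS : ∀ I ∈ S, IsIdeal μ I) :
    IsIdeal μ (sSup S) := by
  constructor
  · intro a
    have : SupSet.sSup S ≤ (SupSet.sSup S).comap (μ a) := sSup_le fun I hI x hx =>
      (le_sSup hI : I ≤ _) ((hS I hI).mul_mem_left a x hx)
    exact this
  · intro a
    have : SupSet.sSup S ≤ (SupSet.sSup S).comap (μ.flip a) := sSup_le fun I hI x hx =>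
      (le_sSup hI : I ≤ _) ((hS I hI).mul_mem_right a x hx)
    exact this

lemma map_symm_map (e : A ≃ₗ[K] A) (I : Submodule K A) :
    (I.map (e : A →ₗ[K] A)).map (e.symm : A →ₗ[K] A) = I := by
  rw [← Submodule.map_comp]
  simp

lemma map_map_symm (e : A ≃ₗ[K] A) (I : Submodule K A) :
    (I.map (e.symm : A →ₗ[K] A)).map (e : A →ₗ[K] A) = I :=
  map_symm_map e.symm I

lemma isomorphic_of_map_eq (he : IsAutomorphism μ e) (hI : IsIdeal μ I) (hJ : IsIdeal μ J)
    (h : I.map (e : A →ₗ[K] A) = J) : Isomorphic hI.mul hJ.mul := by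
  subst h
  exact ⟨e.submoduleMap I, fun x y => Subtype.ext (he x y)⟩

namespace IsMinimalIdeal

lemma map (he : IsAutomorphism μ e) (hI : IsMinimalIdeal μ I) :
    IsMinimalIdeal μ (I.map (e : A →ₗ[K] A)) where
  isIdeal := hI.isIdeal.map he
  ne_bot h := hI.ne_bot (by rw [← map_symm_map e I, h, Submodule.map_bot])
  eq_bot_or_eq J hJ hJI := by
    have h := hI.eq_bot_or_eq _ (hJ.map he.symm)
      ((Submodule.map_mono hJI).trans (map_symm_map e I).le)
    rw [← map_map_symm e J]
    exact h.imp (fun h => by rw [h, Submodule.map_bot]) (fun h => by rw [h])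

lemma iterate_map (he : IsAutomorphism μ e) (hI : IsMinimalIdeal μ I) (k : ℕ) :
    IsMinimalIdeal μ ((Submodule.map (e : A →ₗ[K] A))^[k] I) := by
  induction k with
  | zero => exact hI
  | succ k ih => rw [Function.iterate_succ_apply']; exact ih.map he

/-- Distinct minimal ideals annihilate each other. -/
lemma mul_eq_zero (hI : IsMinimalIdeal μ I) (hJ : IsMinimalIdeal μ J) (hIJ : I ≠ J) {x y : A}
    (hx : x ∈ I) (hy : y ∈ J) : μ x y = 0 := by
  have hmem : μ x y ∈ I ⊓ J :=
    ⟨hI.isIdeal.mul_mem_right y x hx, hJ.isIdeal.mul_mem_left x y hy⟩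
  obtain h | h := hI.eq_bot_or_eq _ (hI.isIdeal.inf hJ.isIdeal) inf_le_left
  · exact (Submodule.mem_bot K).1 (h ▸ hmem)
  · exact absurd ((hJ.eq_bot_or_eq I hI.isIdeal (inf_eq_left.1 h)).resolve_left hI.ne_bot) hIJ

/-- The translates of a minimal ideal span `A`. -/
lemma iSup_iterate (h : IsSimpleUnder μ e) (hI : IsMinimalIdeal μ I) :
    ⨆ k : ℕ, (Submodule.map (e : A →ₗ[K] A))^[k] I = ⊤ := by
  refine (h.eq_bot_or_eq_top _ ?_ ?_).resolve_left fun h0 => ?_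
  · rw [iSup]
    refine IsIdeal.sSup ?_
    rintro _ ⟨k, rfl⟩
    exact (hI.iterate_map h.isAutomorphism k).isIdeal
  · rw [Submodule.map_iSup]
    refine iSup_le fun k => ?_
    rw [← Function.iterate_succ_apply' (Submodule.map (e : A →ₗ[K] A))]
    exact le_iSup (fun k => (Submodule.map (e : A →ₗ[K] A))^[k] I) (k + 1)
  · exact hI.ne_bot (le_bot_iff.1 (h0 ▸ le_iSup (fun k => (Submodule.map (e : A →ₗ[K] A))^[k] I) 0))

/-- If a minimal ideal annihilated `A`, so would its translates, which span `A`. -/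
lemma exists_mul_ne_zero (h : IsSimpleUnder μ e) (hI : IsMinimalIdeal μ I) :
    ∃ x ∈ I, ∃ y, μ x y ≠ 0 := by
  by_contra! h0
  have key : ∀ k : ℕ, ∀ x ∈ (Submodule.map (e : A →ₗ[K] A))^[k] I, ∀ y, μ x y = 0 := by
    intro k
    induction k with
    | zero => exact h0
    | succ k ih =>
      rw [Function.iterate_succ_apply']
      rintro _ ⟨x, hx, rfl⟩ y
      obtain ⟨y, rfl⟩ := e.surjective y
      exact (h.isAutomorphism x y).symm.trans (by rw [ih x hx, map_zero])
  have htop : (⊤ : Submodule K A) ≤ LinearMap.ker μ := by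
    rw [← hI.iSup_iterate h]
    exact iSup_le fun k x hx => LinearMap.mem_ker.2 (LinearMap.ext (key k x hx))
  obtain ⟨a, b, hab⟩ := derived_ne_bot_iff.1 h.derived_ne_bot
  exact hab (by rw [LinearMap.mem_ker.1 (htop trivial : a ∈ _), LinearMap.zero_apply])

/-- The automorphism acts transitively on the minimal ideals: an ideal outside the orbit would
annihilate everything. -/
lemma exists_iterate_eq (h : IsSimpleUnder μ e) (hI : IsMinimalIdeal μ I)
    (hJ : IsMinimalIdeal μ J) : ∃ k : ℕ, (Submodule.map (e : A →ₗ[K] A))^[k] I = J := by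
  by_contra! hne
  obtain ⟨x, hx, y, hxy⟩ := hJ.exists_mul_ne_zero h
  have htop : (⊤ : Submodule K A) ≤ LinearMap.ker (μ x) := by
    rw [← hI.iSup_iterate h]
    exact iSup_le fun k y hy => LinearMap.mem_ker.2
      (hJ.mul_eq_zero (hI.iterate_map h.isAutomorphism k) (hne k).symm hx hy)
  exact hxy (LinearMap.mem_ker.1 (htop trivial))

/-- `A` is the sum of its minimal ideals, stated with the minimal ideal `I` singled out. -/
lemma eq_top_of_le (h : IsSimpleUnder μ e) (hI : IsMinimalIdeal μ I) {P : Submodule K A}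
    (hIP : I ≤ P) (hP : ∀ J, IsMinimalIdeal μ J → I ≠ J → J ≤ P) : P = ⊤ := by
  rw [← top_le_iff, ← hI.iSup_iterate h]
  refine iSup_le fun k => ?_
  by_cases hk : I = (Submodule.map (e : A →ₗ[K] A))^[k] I
  · rwa [← hk]
  · exact hP _ (hI.iterate_map h.isAutomorphism k) hk

lemma exists_mul_self_ne_zero (h : IsSimpleUnder μ e) (hI : IsMinimalIdeal μ I) :
    ∃ x ∈ I, ∃ y ∈ I, μ x y ≠ 0 := by
  by_contra! h0
  obtain ⟨x, hx, y, hxy⟩ := hI.exists_mul_ne_zero h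
  have htop : LinearMap.ker (μ x) = ⊤ := hI.eq_top_of_le h (fun y hy => h0 x hx y hy)
    fun J hJ hIJ y hy => hI.mul_eq_zero hJ hIJ hx hy
  exact hxy (LinearMap.mem_ker.1 (htop ▸ Submodule.mem_top))

/-- An ideal of a minimal ideal `I` is an ideal of `A`, because `A` is spanned by `I` and ideals
that annihilate `I`. -/
lemma isSimpleIdeal (h : IsSimpleUnder μ e) (hI : IsMinimalIdeal μ I) : IsSimpleIdeal μ I := by
  refine ⟨hI.isIdeal, derived_ne_bot_iff.2 ?_, fun L hL => ?_⟩
  · obtain ⟨x, hx, y, hy, hxy⟩ := hI.exists_mul_self_ne_zero h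
    exact ⟨⟨x, hx⟩, ⟨y, hy⟩, fun h0 => hxy (congrArg Subtype.val h0)⟩
  · have hle : L.map I.subtype ≤ I := Submodule.map_subtype_le I L
    have hideal : IsIdeal μ (L.map I.subtype) := by
      constructor
      · rintro a _ ⟨x, hx, rfl⟩
        have htop : (L.map I.subtype).comap (μ.flip x) = ⊤ := hI.eq_top_of_le h
          (fun b hb => ⟨_, hL.mul_mem_left ⟨b, hb⟩ x hx, rfl⟩)
          fun J hJ hIJ b hb => by
            rw [Submodule.mem_comap, LinearMap.flip_apply, hJ.mul_eq_zero hI hIJ.symm hb x.2]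
            exact zero_mem _
        exact (htop ▸ Submodule.mem_top : a ∈ (L.map I.subtype).comap (μ.flip x))
      · rintro a _ ⟨x, hx, rfl⟩
        have htop : (L.map I.subtype).comap (μ x) = ⊤ := hI.eq_top_of_le h
          (fun b hb => ⟨_, hL.mul_mem_right ⟨b, hb⟩ x hx, rfl⟩)
          fun J hJ hIJ b hb => by
            rw [Submodule.mem_comap, hI.mul_eq_zero hJ hIJ x.2 hb]
            exact zero_mem _
        exact (htop ▸ Submodule.mem_top : a ∈ (L.map I.subtype).comap (μ x))
    refine (hI.eq_bot_or_eq _ hideal hle).imp (fun h0 => ?_) fun h1 => ?_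
    · exact Submodule.map_injective_of_injective I.injective_subtype
        (h0.trans (Submodule.map_bot _).symm)
    · exact Submodule.map_injective_of_injective I.injective_subtype
        (h1.trans (Submodule.map_subtype_top I).symm)

end IsMinimalIdeal

lemma IsSimpleIdeal.isMinimalIdeal (hI : IsSimpleIdeal μ I) : IsMinimalIdeal μ I where
  isIdeal := hI.isIdeal
  ne_bot := by
    rintro rfl
    obtain ⟨x, y, hxy⟩ := derived_ne_bot_iff.1 hI.isSimple.derived_ne_bot
    exact hxy (Subsingleton.elim _ _)
  eq_bot_or_eq J hJ hJI := by
    have hJ' : IsIdeal hI.isIdeal.mul (J.comap I.subtype) :=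
      ⟨fun a x hx => hJ.mul_mem_left a x hx, fun a x hx => hJ.mul_mem_right a x hx⟩
    have e : (J.comap I.subtype).map I.subtype = J := by
      rw [Submodule.map_comap_subtype, inf_eq_right.2 hJI]
    refine (hI.isSimple.eq_bot_or_eq_top _ hJ').imp (fun h => ?_) fun h => ?_
    · rw [← e, h, Submodule.map_bot]
    · rw [← e, h, Submodule.map_subtype_top]

lemma IsSimpleUnder.isSimpleIdeal_iff (h : IsSimpleUnder μ e) :
    IsSimpleIdeal μ I ↔ IsMinimalIdeal μ I :=
  ⟨fun hI => hI.isMinimalIdeal, fun hI => hI.isSimpleIdeal h⟩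

namespace IsSimpleUnder

/-- The sum of all other minimal ideals annihilates the minimal ideal `I`, so it does not contain
`I`. -/
lemma sSupIndep (h : IsSimpleUnder μ e) : sSupIndep {I | IsMinimalIdeal μ I} := by
  intro I hI
  rw [disjoint_iff]
  have hideal : IsIdeal μ (sSup ({I | IsMinimalIdeal μ I} \ {I})) :=
    IsIdeal.sSup fun J hJ => IsMinimalIdeal.isIdeal hJ.1
  refine (hI.eq_bot_or_eq _ (hI.isIdeal.inf hideal) inf_le_left).resolve_right fun h1 => ?_
  obtain ⟨x, hx, y, hy, hxy⟩ := hI.exists_mul_self_ne_zero h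
  have hle : sSup ({I | IsMinimalIdeal μ I} \ {I}) ≤ LinearMap.ker (μ x) :=
    sSup_le fun J hJ z hz => hI.mul_eq_zero hJ.1 (Ne.symm hJ.2) hx hz
  exact hxy (hle (inf_eq_left.1 h1 hy))

open Function in
lemma minimalPeriod_pos (h : IsSimpleUnder μ e) (hI : IsMinimalIdeal μ I) :
    0 < minimalPeriod (Submodule.map (e : A →ₗ[K] A)) I := by
  obtain ⟨k, hk⟩ := (hI.map h.isAutomorphism).exists_iterate_eq h hI
  exact IsPeriodicPt.minimalPeriod_pos k.succ_pos hk

open Function in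
/-- The minimal ideals are the first `p` translates of any one of them, where `p` is its period. -/
lemma setOf_isMinimalIdeal_eq (h : IsSimpleUnder μ e) (hI : IsMinimalIdeal μ I) :
    {J | IsMinimalIdeal μ J} = (fun k => (Submodule.map (e : A →ₗ[K] A))^[k] I) ''
      Set.Iio (minimalPeriod (Submodule.map (e : A →ₗ[K] A)) I) := by
  ext J
  constructor
  · intro hJ
    obtain ⟨k, rfl⟩ := hI.exists_iterate_eq h hJ
    exact ⟨k % _, Nat.mod_lt _ (h.minimalPeriod_pos hI), iterate_mod_minimalPeriod_eq⟩
  · rintro ⟨k, -, rfl⟩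
    exact hI.iterate_map h.isAutomorphism k

open Function in
lemma ncard_eq_minimalPeriod (h : IsSimpleUnder μ e) (hI : IsMinimalIdeal μ I) :
    {J | IsMinimalIdeal μ J}.ncard = minimalPeriod (Submodule.map (e : A →ₗ[K] A)) I := by
  rw [h.setOf_isMinimalIdeal_eq hI, iterate_injOn_Iio_minimalPeriod.ncard_image]
  simp [Set.ncard_eq_toFinset_card']

/-- The automorphism acts simply transitively on the minimal ideals. -/
lemma existsUnique_iterate (h : IsSimpleUnder μ e) (hI : IsMinimalIdeal μ I)
    (hJ : IsMinimalIdeal μ J) : ∃! k : ℕ, k < {J | IsMinimalIdeal μ J}.ncard ∧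
      (Submodule.map (e : A →ₗ[K] A))^[k] I = J := by
  rw [h.ncard_eq_minimalPeriod hI]
  have hJ' : J ∈ {J | IsMinimalIdeal μ J} := hJ
  rw [h.setOf_isMinimalIdeal_eq hI] at hJ'
  obtain ⟨k, hk, hkJ⟩ := hJ'
  exact ⟨k, ⟨hk, hkJ⟩, fun j ⟨hj, hjJ⟩ =>
    Function.iterate_injOn_Iio_minimalPeriod hj hk (hjJ.trans hkJ.symm)⟩

lemma isInternal (h : IsSimpleUnder μ e) (hI : IsMinimalIdeal μ I) :
    DirectSum.IsInternal (fun k : Fin {J | IsMinimalIdeal μ J}.ncard =>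
      (Submodule.map (e : A →ₗ[K] A))^[(k : ℕ)] I) := by
  refine (DirectSum.isInternal_submodule_iff_iSupIndep_and_iSup_eq_top _).2 ⟨?_, ?_⟩
  · have hinj : Function.Injective (fun k : Fin {J | IsMinimalIdeal μ J}.ncard =>
        (⟨(Submodule.map (e : A →ₗ[K] A))^[(k : ℕ)] I, hI.iterate_map h.isAutomorphism k⟩ :
          {J | IsMinimalIdeal μ J})) := by
      intro i j hij
      exact Fin.ext ((h.existsUnique_iterate hI (hI.iterate_map h.isAutomorphism j)).unique
        ⟨i.2, congrArg Subtype.val hij⟩ ⟨j.2, rfl⟩)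
    exact ((sSupIndep_iff _).1 h.sSupIndep).comp hinj
  · refine hI.eq_top_of_le h ?_ fun J hJ _ => ?_
    · obtain ⟨k, ⟨hk, hkI⟩, -⟩ := h.existsUnique_iterate hI hI
      exact hkI.ge.trans (le_iSup (fun k : Fin {J | IsMinimalIdeal μ J}.ncard =>
        (Submodule.map (e : A →ₗ[K] A))^[(k : ℕ)] I) ⟨k, hk⟩)
    · obtain ⟨k, ⟨hk, hkI⟩, -⟩ := h.existsUnique_iterate hI hJ
      exact hkI.ge.trans (le_iSup (fun k : Fin {J | IsMinimalIdeal μ J}.ncard =>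
        (Submodule.map (e : A →ₗ[K] A))^[(k : ℕ)] I) ⟨k, hk⟩)

lemma bijOn (h : IsSimpleUnder μ e) : Set.BijOn (Submodule.map (e : A →ₗ[K] A))
    {I | IsMinimalIdeal μ I} {I | IsMinimalIdeal μ I} :=
  ⟨fun _ hI => IsMinimalIdeal.map h.isAutomorphism hI,
    (Submodule.map_injective_of_injective e.injective).injOn,
    fun I hI => ⟨_, IsMinimalIdeal.map h.isAutomorphism.symm hI, map_map_symm e I⟩⟩

lemma exists_isMinimalIdeal [FiniteDimensional K A] (h : IsSimpleUnder μ e) :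
    ∃ I, IsMinimalIdeal μ I := by
  have hne : (⊤ : Submodule K A) ≠ ⊥ := fun h0 => h.derived_ne_bot (le_bot_iff.1 (h0 ▸ le_top))
  obtain ⟨I, ⟨hI, hI0⟩, hmin⟩ := WellFounded.has_min (wellFounded_lt (α := Submodule K A))
    {I | IsIdeal μ I ∧ I ≠ ⊥} ⟨⊤, ⟨fun _ _ _ => trivial, fun _ _ _ => trivial⟩, hne⟩
  refine ⟨I, hI, hI0, fun J hJ hJI => ?_⟩
  by_contra! hne
  exact hmin J ⟨hJ, hne.1⟩ (lt_of_le_of_ne hJI hne.2)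

lemma isSemisimple [FiniteDimensional K A] (h : IsSimpleUnder μ e) : IsSemisimple μ := by
  obtain ⟨I, hI⟩ := h.exists_isMinimalIdeal
  exact ⟨_, _, fun k => (hI.iterate_map h.isAutomorphism k).isSimpleIdeal h, h.isInternal hI⟩

lemma isomorphic (h : IsSimpleUnder μ e) (hI : IsSimpleIdeal μ I) (hJ : IsSimpleIdeal μ J) :
    Isomorphic hI.isIdeal.mul hJ.isIdeal.mul := by
  obtain ⟨k, hk⟩ := hI.isMinimalIdeal.exists_iterate_eq h hJ.isMinimalIdeal
  refine isomorphic_of_map_eq (h.isAutomorphism.pow k) _ _ ?_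
  rw [coe_pow_linearEquiv, map_pow_eq_iterate, hk]

end IsSimpleUnder

/-! ### The induced alternative algebra -/

namespace IsSimpleHomAlternative

variable {α : A →ₗ[K] A}

/-- The kernel of the twisting map is a Hom-ideal. -/
lemma injective (h : IsSimpleHomAlternative μ α) : Function.Injective α := by
  have hker : IsHomIdeal μ α (LinearMap.ker α) := by
    refine ⟨fun x hx => ?_, fun a x hx => ?_, fun a x hx => ?_⟩ <;>
      rw [LinearMap.mem_ker] at hx ⊢
    · rw [hx, map_zero]
    · rw [h.isHomAlternative.multiplicative, hx, map_zero]
    · rw [h.isHomAlternative.multiplicative, hx, LinearMap.map_zero₂]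
  exact LinearMap.ker_eq_bot.1 ((h.eq_bot_or_eq_top _ hker).resolve_right fun h0 =>
    h.twist_ne_zero (LinearMap.ker_eq_top.1 h0))

-- `μ` is the product of the Hom-alternative algebra here, and `e⁻¹ ∘ μ` the induced one
variable (h : IsSimpleHomAlternative μ (e : A →ₗ[K] A))
include h

lemma isAutomorphism_twist_symm : IsAutomorphism (twist (e.symm : A →ₗ[K] A) μ) e := by
  intro x y
  have hm : e (μ x y) = μ (e x) (e y) := h.isHomAlternative.multiplicative x y
  simp [twist, ← hm]

lemma isAlternative_twist_symm : IsAlternative (twist (e.symm : A →ₗ[K] A) μ) := by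
  have hm : ∀ x y, μ (e x) (e y) = e (μ x y) := fun x y =>
    (h.isHomAlternative.multiplicative x y).symm
  have key : ∀ x y z, homAssociator μ (e : A →ₗ[K] A) x y z = 0 →
      μ (e.symm (μ x y)) z = μ x (e.symm (μ y z)) := by
    intro x y z hxyz
    rw [homAssociator, sub_eq_zero] at hxyz
    apply e.injective
    rw [← hm, ← hm, e.apply_symm_apply, e.apply_symm_apply]
    exact hxyz
  constructor <;> intro x y <;> simp only [twist, LinearMap.compr₂_apply, LinearEquiv.coe_coe] <;>
    rw [key]
  · exact h.isHomAlternative.left_alternative x y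
  · exact h.isHomAlternative.right_alternative x y

/-- An ideal of the induced algebra which `e` maps into itself is a Hom-ideal. -/
lemma isSimpleUnder_twist_symm : IsSimpleUnder (twist (e.symm : A →ₗ[K] A) μ) e where
  isAutomorphism := h.isAutomorphism_twist_symm
  derived_ne_bot := by
    obtain ⟨a, b, hab⟩ := derived_ne_bot_iff.1 h.derived_ne_bot
    exact derived_ne_bot_iff.2 ⟨a, b, by simpa [twist] using hab⟩
  eq_bot_or_eq_top I hI hmap := by
    have hmem : ∀ x ∈ I, e x ∈ I := fun x hx => hmap ⟨x, hx, rfl⟩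
    refine h.eq_bot_or_eq_top I ⟨hmem, fun a x hx => ?_, fun a x hx => ?_⟩
    · simpa [twist] using hmem _ (hI.mul_mem_left a x hx)
    · simpa [twist] using hmem _ (hI.mul_mem_right a x hx)

end IsSimpleHomAlternative

end HomAlt

theorem mainTheorem1 {K A : Type*} [Field K] [CharZero K] [AddCommGroup A] [Module K A] :
    (FiniteDimensional K A →
      ∀ (μ : A →ₗ[K] A →ₗ[K] A) (α : A →ₗ[K] A), HomAlt.IsSimpleHomAlternative μ α →
        -- `α` is invertible, so that the induced product `μ' = α⁻¹ ∘ μ` exists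
        ∃ e : A ≃ₗ[K] A, (e : A →ₗ[K] A) = α ∧
          ∃ μ' : A →ₗ[K] A →ₗ[K] A, μ' = HomAlt.twist (e.symm : A →ₗ[K] A) μ ∧
            HomAlt.IsAlternative μ' ∧
            HomAlt.IsAutomorphism μ' e ∧
            HomAlt.IsSemisimple μ' ∧
            -- any two simple ideals are isomorphic algebras
            (∀ (I J : Submodule K A) (hI : HomAlt.IsSimpleIdeal μ' I)
              (hJ : HomAlt.IsSimpleIdeal μ' J),
                HomAlt.Isomorphic hI.isIdeal.mul hJ.isIdeal.mul) ∧
            -- `m` is the (finite, positive) number of simple ideals; `α` permutes them simply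
            -- transitively, and `A` is the direct sum of the first `m` translates of any of them
            ∃ m : ℕ, 0 < m ∧ {I : Submodule K A | HomAlt.IsSimpleIdeal μ' I}.ncard = m ∧
              Set.BijOn (Submodule.map α) {I : Submodule K A | HomAlt.IsSimpleIdeal μ' I}
                {I : Submodule K A | HomAlt.IsSimpleIdeal μ' I} ∧
              (∀ I J : Submodule K A, HomAlt.IsSimpleIdeal μ' I → HomAlt.IsSimpleIdeal μ' J →
                ∃! k : ℕ, k < m ∧ Submodule.map (α ^ k) I = J) ∧
              (∀ I : Submodule K A, HomAlt.IsSimpleIdeal μ' I →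
                DirectSum.IsInternal (fun k : Fin m => Submodule.map (α ^ (k : ℕ)) I))) ∧
    (∀ (μ' : A →ₗ[K] A →ₗ[K] A) (α : A ≃ₗ[K] A),
      HomAlt.IsAlternative μ' → HomAlt.IsSimple μ' → HomAlt.IsAutomorphism μ' α →
        HomAlt.IsSimpleHomAlternative
          (HomAlt.twist (α : A →ₗ[K] A) μ') (α : A →ₗ[K] A)) := by
  refine ⟨fun _ μ α h => ?_, fun μ' α ha h hα => h.isSimpleHomAlternative_twist ha hα⟩
  obtain ⟨e, rfl⟩ : ∃ e : A ≃ₗ[K] A, (e : A →ₗ[K] A) = α :=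
    ⟨LinearEquiv.ofInjectiveEndo α h.injective, LinearMap.ext fun _ => rfl⟩
  have hs := h.isSimpleUnder_twist_symm
  have hset : {I | HomAlt.IsSimpleIdeal (HomAlt.twist (e.symm : A →ₗ[K] A) μ) I} =
      {I | HomAlt.IsMinimalIdeal (HomAlt.twist (e.symm : A →ₗ[K] A) μ) I} :=
    Set.ext fun I => hs.isSimpleIdeal_iff
  obtain ⟨I₀, hI₀⟩ := hs.exists_isMinimalIdeal
  refine ⟨e, rfl, _, rfl, h.isAlternative_twist_symm, hs.isAutomorphism, hs.isSemisimple,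
    fun I J hI hJ => hs.isomorphic hI hJ, _, ?_, rfl, ?_, fun I J hI hJ => ?_, fun I hI => ?_⟩
  · rw [hset, hs.ncard_eq_minimalPeriod hI₀]
    exact hs.minimalPeriod_pos hI₀
  · rw [hset]
    exact hs.bijOn
  · simp only [hset, HomAlt.map_pow_eq_iterate]
    exact hs.existsUnique_iterate hI.isMinimalIdeal hJ.isMinimalIdeal
  · simp only [HomAlt.map_pow_eq_iterate]
    rw [hset]
    exact hs.isInternal hI.isMinimalIdeal
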